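/- Let $\mathcal O$ be the algebra of entire functions on $\mathbb C$, $D=t\frac{d}{dt}$, and let $\mathcal{SD}^{\mathcal O}$ be the associative superalgebra of $2\times 2$ matrices whose entries are finite sums $\sum_{k\in\mathbb Z}t^kf_k(D)$, $f_k\in\mathcal O$, with $t^rf(D)\cdot t^qg(D)=t^{r+q}f(D+q)g(D)$. It is the holomorphic completion of the algebra of differential operators on the super circle. Its matrix units are $M_0=E_{00}=\partial_\theta\theta$ and $M_1=E_{11}=\theta\partial_\theta$ (even), $M_+=E_{01}=\partial_\theta$ and $M_-=E_{10}=\theta$ (odd). An associative superalgebra is a Lie superalgebra under the super-bracket $[x,y]=xy-(-1)^{|x||y|}yx$. An anti-involution satisfies $\sigma(xy)=(-1)^{|x||y|}\sigma(y)\sigma(x)$. Let ${}^0\sigma$ be the one with $t\mapsto -t$, $D\mapsto -D-1+\partial_\theta\theta$, $\theta\mapsto t\partial_\theta$, $\partial_\theta\mapsto -t^{-1}\theta$. For signs $c,d\in\{1,-1\}$ let ${}^{cd}\sigma$ be the one with $t\mapsto ct$, $D\mapsto -D-1$, $\theta\mapsto d\theta$, $\partial_\theta\mapsto -d\,\partial_\theta$;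 all are extended to entire functions of $D$ by $\sigma(f(D))=f(\sigma(D))$. Put ${}^0\mathcal{SD}^{\mathcal O}=\{x\in\mathcal{SD}^{\mathcal O}: {}^0\sigma(x)=-x\}$ and ${}^{cd}\mathcal{SD}^{\mathcal O}=\{x\in\mathcal{SD}^{\mathcal O}: {}^{cd}\sigma(x)=-x\}$. Let $\mathbb C^{\infty|\infty}$ have even basis $e_i$ ($i\in\mathbb Z$) and odd basis $e_r$ ($r\in\frac12+\mathbb Z$). Let $gl_{\infty|\infty}$ be the Lie superalgebra of matrices $(a_{ij})_{i,j\in\frac12\mathbb Z}$ with $a_{ij}=0$ for $|i-j|\gg0$, acting on $\mathbb C^{\infty|\infty}$ by $E_{ij}e_k=\delta_{jk}e_i$. A homogeneous $T$ preserves a bilinear form if $(Tv|w)=-(-1)^{|T||v|}(v|Tw)$ for all homogeneous $v$ and all $w$; the subalgebra preserving the form is the span of such $T$. Let $\mathcal B$ be the subalgebra preserving the even form with $(e_i|e_j)=(-1)^i\delta_{i,-j}$ for $i,j\in\mathbb Z$, $(e_r|e_q)=(-1)^{r+1/2}\delta_{r,-q}$ for $r,q\in\frac12+\mathbb Z$,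 and $(e_i|e_r)=(e_r|e_i)=0$. Let $\mathcal P_{cd}$ be the subalgebra preserving the odd form with $(e_i|e_{j-1/2})=c^i\delta_{i+j,1}$ and $(e_{j-1/2}|e_i)=cd\,(e_i|e_{j-1/2})$ for $i,j\in\mathbb Z$; so the form is symmetric for $\mathcal P_{++},\mathcal P_{--}$ and skew-symmetric for $\mathcal P_{+-},\mathcal P_{-+}$. For $s\in\mathbb C$ let $\phi_s:\mathcal{SD}^{\mathcal O}\to gl_{\infty|\infty}$ be the action on $\mathbb C^{\infty|\infty}=t^s\mathbb C[t,t^{-1}]\oplus\theta t^s\mathbb C[t,t^{-1}]$ with $e_i=t^{-i+s}$, $e_{i-1/2}=t^{-i+s}\theta$ for $i\in\mathbb Z$. That is, $\phi_s(t^kf(D)M_a)=\sum_{j\in\mathbb Z}f(-j+s)E_{j-k,j}M_a$, where $E_{ij}M_0=E_{ij}$, $E_{ij}M_1=E_{i-1/2,j-1/2}$, $E_{ij}M_+=E_{i,j-1/2}$, $E_{ij}M_-=E_{i-1/2,j}$. Let $I_s=\{f\in\mathcal O: f(n+s)=0\ \forall n\in\mathbb Z\}$ and $$I^{(j)}_{s,k}=\{f\in\mathcal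 O: f(-w)=(-1)^jf(w),\ f(n+\tfrac k2+s)=0\ \forall n\in\mathbb Z\}.$$ Let ${}^0J_s$ be the linear span, over all $k\in\mathbb Z$, of $$t^kf_0(D+\tfrac k2)M_0,\qquad t^kf_1(D+\tfrac{k+1}2)M_1,\qquad (-t)^kg(-D-k)M_++t^{k-1}g(D)M_-,$$ with $f_0\in I^{(k+1)}_{s,k}$, $f_1\in I^{(k+1)}_{s,k+1}$, $g\in I_s\cap I_{-s}$. Let ${}^{cd}J_s$ be the linear span, over all $k\in\mathbb Z$, of $$t^k\bigl(f(D)M_0-c^kf(-D-k-1)M_1\bigr),\qquad t^{k-1}f_-(D+\tfrac k2)M_-,\qquad t^kf_+(D+\tfrac{k+1}2)M_+,$$ with $f\in I_s\cap I_{-s}$, $f_-\in I^{(a)}_{s,k}$, $f_+\in I^{(b)}_{s,k+1}$, where $(-1)^a=-d\,c^{k+1}$ and $(-1)^b=d\,c^k$. Then there are short exact sequences of Lie superalgebras $$0\to{}^0J_s\to{}^0\mathcal{SD}^{\mathcal O}\xrightarrow{\phi_s}gl_{\infty|\infty}\to0\quad(s\notin\tfrac12\mathbb Z),\qquad 0\to{}^0J_0\to{}^0\mathcal{SD}^{\mathcal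 O}\xrightarrow{\phi_0}\mathcal B\to0,$$ and, for each of the four choices of signs $c,d$, $$0\to{}^{cd}J_s\to{}^{cd}\mathcal{SD}^{\mathcal O}\xrightarrow{\phi_s}gl_{\infty|\infty}\to0\quad(s\notin\tfrac12\mathbb Z),\qquad 0\to{}^{cd}J_0\to{}^{cd}\mathcal{SD}^{\mathcal O}\xrightarrow{\phi_0}\mathcal P_{cd}\to0.$$ -/

import Mathlib

noncomputable section

namespace SuperCircle

open DirectSum

/-! ### Generalities on Lie superalgebras

An associative superalgebra over `ℂ` is a `ZMod 2`-graded algebra (`GradedAlgebra`).  Its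
super-bracket makes it into a Lie superalgebra. -/

/-- The sign `(-1)^{pq}` for parities `p`, `q`. -/
def superSign (p q : ZMod 2) : ℂ := (-1) ^ (p.val * q.val)

section Super

variable {A : Type} [Ring A] [Algebra ℂ A] (𝒜 : ZMod 2 → Submodule ℂ A) [GradedAlgebra 𝒜]

/-- The super-bracket of an associative superalgebra, the bilinear extension of
`[x, y] = x y - (-1)^{|x||y|} y x` for homogeneous `x`, `y`. -/
def superBracket (x y : A) : A :=
  ∑ p : ZMod 2, ∑ q : ZMod 2,
    ((decompose 𝒜 x p : A) * (decompose 𝒜 y q : A)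
      - superSign p q • ((decompose 𝒜 y q : A) * (decompose 𝒜 x p : A)))

/-- A Lie sub-superalgebra: a `ZMod 2`-graded subspace closed under the super-bracket. -/
structure IsLieSubsuperalgebra (L : Submodule ℂ A) : Prop where
  graded : ∀ x ∈ L, ∀ p, (decompose 𝒜 x p : A) ∈ L
  bracket_mem : ∀ x ∈ L, ∀ y ∈ L, superBracket 𝒜 x y ∈ L

/-- `J` is a (graded) ideal of the Lie superalgebra `L`. -/
structure IsLieSuperideal (J L : Submodule ℂ A) : Prop where
  le : J ≤ L
  graded : ∀ x ∈ J, ∀ p, (decompose 𝒜 x p : A) ∈ J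
  bracket_mem : ∀ x ∈ L, ∀ y ∈ J, superBracket 𝒜 x y ∈ J

/-- `0 ⟶ J ⟶ L ⟶ G ⟶ 0`, with the inclusion and the restriction of `φ`, is a short exact sequence
of Lie superalgebras. -/
structure IsShortExact {B : Type} [Ring B] [Algebra ℂ B] (ℬ : ZMod 2 → Submodule ℂ B)
    [GradedAlgebra ℬ] (J L : Submodule ℂ A) (φ : A →ₗ[ℂ] B) (G : Submodule ℂ B) : Prop where
  source : IsLieSubsuperalgebra 𝒜 L
  target : IsLieSubsuperalgebra ℬ G
  ideal : IsLieSuperideal 𝒜 J L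
  map_parity : ∀ p, ∀ x ∈ L, x ∈ 𝒜 p → φ x ∈ ℬ p
  map_bracket : ∀ x ∈ L, ∀ y ∈ L, φ (superBracket 𝒜 x y) = superBracket ℬ (φ x) (φ y)
  kernel : L ⊓ LinearMap.ker φ = J
  range : L.map φ = G

end Super

/-- A family of complementary projections gives a decomposition. -/
@[reducible] def decompositionOfParts {A : Type} [AddCommMonoid A] [Module ℂ A] (𝒜 : ZMod 2 → Submodule ℂ A)
    (P : ZMod 2 → A → A) (hmem : ∀ p x, P p x ∈ 𝒜 p)
    (hadd : ∀ p x y, P p (x + y) = P p x + P p y)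
    (hsum : ∀ x, ∑ p, P p x = x)
    (hid : ∀ p, ∀ x ∈ 𝒜 p, ∀ q, P q x = if q = p then x else 0) : Decomposition 𝒜 where
  decompose' x := ∑ p, DirectSum.of (fun p => 𝒜 p) p ⟨P p x, hmem p x⟩
  left_inv x := by
    simp only [map_sum, DirectSum.coeAddMonoidHom_of]
    exact hsum x
  right_inv x := by
    induction x using DirectSum.induction_on with
    | zero =>
      have h0 : ∀ p, (⟨P p 0, hmem p 0⟩ : 𝒜 p) = 0 := fun p => by
        ext
        simp [hid p 0 (zero_mem _) p]
      simp [h0]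
    | of p x =>
      rw [DirectSum.coeAddMonoidHom_of]
      refine (Finset.sum_eq_single p (fun q _ hq => ?_) (by simp)).trans ?_
      · have h0 : (⟨P q x, hmem q x⟩ : 𝒜 q) = 0 := by
          ext
          simp [hid p x x.2 q, hq]
        rw [h0, map_zero]
      · congr 1
        ext
        simp [hid p x x.2 p]
    | add x y hx hy =>
      rw [map_add]
      conv_rhs => rw [← hx, ← hy]
      rw [← Finset.sum_add_distrib]
      refine Finset.sum_congr rfl fun p _ => ?_
      refine Eq.trans ?_ (map_add (DirectSum.of (fun p => 𝒜 p) p) _ _)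
      refine congrArg (DirectSum.of (fun p => 𝒜 p) p) (Subtype.ext ?_)
      simp [hadd]

/-! ### Entire functions and differential operators on the circle -/

/-- The algebra `𝒪` of holomorphic functions on `ℂ`. -/
def entire : Subalgebra ℂ (ℂ → ℂ) where
  carrier := {f | Differentiable ℂ f}
  mul_mem' hf hg := Differentiable.mul hf hg
  add_mem' hf hg := Differentiable.add hf hg
  algebraMap_mem' c := differentiable_const c

/-- The substitution `f(w) ↦ f(a w + b)` on entire functions. -/
def affComp (a b : ℂ) : entire →ₐ[ℂ] entire where
  toFun f := ⟨fun w => f.1 (a * w + b),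
    Differentiable.comp (g := f.1) f.2 ((differentiable_id.const_mul a).add_const b)⟩
  map_one' := rfl
  map_mul' _ _ := rfl
  map_zero' := rfl
  map_add' _ _ := rfl
  commutes' _ := rfl

/-- The holomorphic completion of the algebra of differential operators on the circle.  The
element with coefficients `f_k` stands for the finite sum `∑_k t^k f_k(D)`, `D = t ∂_t`. -/
def DiffOp : Type := ℤ →₀ entire

namespace DiffOp

instance : AddCommGroup DiffOp := inferInstanceAs (AddCommGroup (ℤ →₀ entire))
instance : Module ℂ DiffOp := inferInstanceAs (Module ℂ (ℤ →₀ entire))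

/-- The operator `t^k f(D)`. -/
def tD (k : ℤ) : entire →ₗ[ℂ] DiffOp := Finsupp.lsingle k

/-- The linear map on differential operators with prescribed values on `t^k f(D)`. -/
def lift {M : Type} [AddCommMonoid M] [Module ℂ M] (F : ℤ → entire →ₗ[ℂ] M) : DiffOp →ₗ[ℂ] M :=
  Finsupp.lsum ℂ F

theorem lift_tD {M : Type} [AddCommMonoid M] [Module ℂ M] (F : ℤ → entire →ₗ[ℂ] M)
    (k : ℤ) (f : entire) : lift F (tD k f) = F k f :=
  Finsupp.sum_single_index (F k).map_zero

@[elab_as_elim]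
theorem induction {p : DiffOp → Prop} (zero : p 0)
    (add : ∀ x y, p x → p y → p (x + y)) (tD : ∀ k f, p (tD k f)) (x : DiffOp) : p x :=
  Finsupp.induction_linear (motive := p) x zero add tD

/-- The product, determined by `t^r f(D) · t^s g(D) = t^{r+s} f(D+s) g(D)`. -/
instance : Mul DiffOp where
  mul x y := Finsupp.sum x fun r f => Finsupp.sum y fun s g => tD (r + s) (affComp 1 s f * g)

instance : One DiffOp := ⟨tD 0 1⟩

theorem mul_def (x y : DiffOp) : x * y =
    Finsupp.sum x fun r f => Finsupp.sum y fun s g => tD (r + s) (affComp 1 s f * g) := rfl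

theorem one_def : (1 : DiffOp) = tD 0 1 := rfl

theorem tD_mul_tD (r s : ℤ) (f g : entire) :
    tD r f * tD s g = tD (r + s) (affComp 1 s f * g) := by
  refine (Finsupp.sum_single_index ?_).trans (Finsupp.sum_single_index ?_)
  · simp only [map_zero, zero_mul]
    exact Finsupp.sum_fun_zero _
  · simp

protected theorem zero_mul (x : DiffOp) : 0 * x = 0 := Finsupp.sum_zero_index

protected theorem mul_zero (x : DiffOp) : x * 0 = 0 := Finsupp.sum_fun_zero x

protected theorem add_mul (x y z : DiffOp) : (x + y) * z = x * z + y * z := by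
  refine Finsupp.sum_add_index' (fun r => ?_) (fun r f g => ?_)
  · simp only [map_zero, zero_mul]
    exact Finsupp.sum_fun_zero _
  · simp only [map_add, add_mul]
    exact Finsupp.sum_add

protected theorem mul_add (x y z : DiffOp) : x * (y + z) = x * y + x * z := by
  refine Eq.trans (Finsupp.sum_congr fun r _ => ?_) Finsupp.sum_add
  refine Finsupp.sum_add_index' (fun r => ?_) (fun r f g => ?_)
  · simp
  · simp only [map_add, mul_add]

theorem affComp_affComp (r s : ℂ) (f : entire) :
    affComp 1 s (affComp 1 r f) = affComp 1 (r + s) f := by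
  refine Subtype.ext (funext fun w => ?_)
  exact congrArg f.1 (by ring : 1 * (1 * w + s) + r = 1 * w + (r + s))

theorem affComp_one_zero (f : entire) : affComp 1 0 f = f := by
  refine Subtype.ext (funext fun w => ?_)
  exact congrArg f.1 (by ring : 1 * w + 0 = w)

protected theorem mul_assoc (x y z : DiffOp) : x * y * z = x * (y * z) := by
  induction x using induction with
  | zero => simp only [DiffOp.zero_mul]
  | add x x' hx hx' => simp only [DiffOp.add_mul, hx, hx']
  | tD r f =>
  induction y using induction with
  | zero => simp only [DiffOp.zero_mul, DiffOp.mul_zero]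
  | add x x' hx hx' => simp only [DiffOp.add_mul, DiffOp.mul_add, hx, hx']
  | tD s g =>
  induction z using induction with
  | zero => simp only [DiffOp.mul_zero]
  | add x x' hx hx' => simp only [DiffOp.mul_add, hx, hx']
  | tD u h =>
  simp only [tD_mul_tD, map_mul, affComp_affComp, mul_assoc, add_assoc, Int.cast_add]

protected theorem one_mul (x : DiffOp) : 1 * x = x := by
  induction x using induction with
  | zero => exact DiffOp.mul_zero _
  | add x x' hx hx' => rw [DiffOp.mul_add, hx, hx']
  | tD r f => rw [one_def, tD_mul_tD, map_one, one_mul, zero_add]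

protected theorem mul_one (x : DiffOp) : x * 1 = x := by
  induction x using induction with
  | zero => exact DiffOp.zero_mul _
  | add x x' hx hx' => rw [DiffOp.add_mul, hx, hx']
  | tD r f => rw [one_def, tD_mul_tD, mul_one, add_zero, Int.cast_zero, affComp_one_zero]

instance : Ring DiffOp where
  __ := (inferInstance : AddCommGroup DiffOp)
  zero_mul := DiffOp.zero_mul
  mul_zero := DiffOp.mul_zero
  left_distrib := DiffOp.mul_add
  right_distrib := DiffOp.add_mul
  mul_assoc := DiffOp.mul_assoc
  one_mul := DiffOp.one_mul
  mul_one := DiffOp.mul_one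

instance : Algebra ℂ DiffOp :=
  Algebra.ofModule
    (fun c x y => by
      induction x using induction with
      | zero => simp
      | add x x' hx hx' => simp only [smul_add, add_mul, hx, hx']
      | tD r f =>
      induction y using induction with
      | zero => simp
      | add x x' hx hx' => simp only [smul_add, mul_add, hx, hx']
      | tD s g => rw [← map_smul, tD_mul_tD, tD_mul_tD, ← map_smul, map_smul, smul_mul_assoc])
    (fun c x y => by
      induction x using induction with
      | zero => simp
      | add x x' hx hx' => simp only [smul_add, add_mul, hx, hx']
      | tD r f =>
      induction y using induction with
      | zero => simp
      | add x x' hx hx' => simp only [smul_add, mul_add, hx, hx']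
      | tD s g => rw [← map_smul, tD_mul_tD, tD_mul_tD, ← map_smul, mul_smul_comm])

end DiffOp

/-! ### Differential operators on the super circle -/

/-- The holomorphic completion `SD^𝒪` of the algebra of differential operators on the super circle:
`2 × 2` matrices over `DiffOp`.  Index `0` is even and index `1` is odd, so the matrix units are
`M_0 = E_{00} = ∂_θ θ`, `M_1 = E_{11} = θ ∂_θ`, `M_+ = E_{01} = ∂_θ`, `M_- = E_{10} = θ`. -/
abbrev SD : Type := Matrix (ZMod 2) (ZMod 2) DiffOp

/-- The matrix unit `M_a`; `M 0 0 = M_0`, `M 1 1 = M_1`, `M 0 1 = M_+`, `M 1 0 = M_-`. -/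
def M (a b : ZMod 2) : SD := Matrix.single a b 1

/-- The element `t^k f(D) M_{ab}` of `SD^𝒪`. -/
def tDM (k : ℤ) (f : entire) (a b : ZMod 2) : SD := Matrix.single a b (DiffOp.tD k f)

/-- Elements of parity `p`. -/
def SDParity (p : ZMod 2) : Submodule ℂ SD where
  carrier := {X | ∀ a b, a + b ≠ p → X a b = 0}
  add_mem' hX hY a b h := by simp [hX a b h, hY a b h]
  zero_mem' _ _ _ := rfl
  smul_mem' c X hX a b h := by simp [hX a b h]

instance : GradedAlgebra SDParity where
  one_mem a b h := by
    refine Matrix.one_apply_ne ?_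
    rintro rfl
    exact h (CharTwo.add_self_eq_zero a)
  mul_mem p q X Y hX hY a b h := by
    rw [Matrix.mul_apply]
    refine Finset.sum_eq_zero fun c _ => ?_
    by_cases h1 : a + c = p
    · have h2 : c + b ≠ q := by
        rintro rfl
        apply h
        rw [← h1, add_add_add_comm, add_assoc a, ← add_assoc c, CharTwo.add_self_eq_zero, zero_add]
      rw [hY c b h2, mul_zero]
    · rw [hX a c h1, zero_mul]
  toDecomposition := decompositionOfParts SDParity
    (fun p X => Matrix.of fun a b => if a + b = p then X a b else 0)
    (fun p X a b h => by simp [h])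
    (fun p X Y => by ext a b : 2; by_cases h : a + b = p <;> simp [h])
    (fun X => by ext a b : 2; simp [Matrix.sum_apply])
    (fun p X hX q => by
      ext a b : 2
      by_cases h : a + b = p
      · by_cases h' : q = p
        · simp [h, h']
        · simp [h, h', Ne.symm h']
      · by_cases h' : q = p <;> simp [h', hX a b h])

/-! ### Anti-involutions and their fixed subalgebras -/

/-- The element `(c t)^k` of `SD^𝒪`, for a sign `c`. -/
def signedT (c : ℤˣ) (k : ℤ) : SD := ((c ^ k : ℤˣ) : ℤ) • Matrix.scalar (ZMod 2) (DiffOp.tD k 1)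

/-- The linear map `σ` of `SD^𝒪` with `σ(t^k f(D) M_{ab}) = σ(M_{ab}) · f(σ(D)) · (c t)^k`,
where `σ(t) = c t`, `σ(M_{ab}) = N a b` and `f(σ(D)) = F f` (see `antiMap_tDM`). -/
def antiMap (c : ℤˣ) (N : ZMod 2 → ZMod 2 → SD) (F : entire →ₗ[ℂ] SD) : SD →ₗ[ℂ] SD :=
  ∑ a : ZMod 2, ∑ b : ZMod 2,
    (DiffOp.lift fun k : ℤ =>
      LinearMap.mulRight ℂ (signedT c k) ∘ₗ LinearMap.mulLeft ℂ (N a b) ∘ₗ F) ∘ₗ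
      Matrix.entryLinearMap ℂ DiffOp a b

theorem antiMap_tDM (c : ℤˣ) (N : ZMod 2 → ZMod 2 → SD) (F : entire →ₗ[ℂ] SD)
    (k : ℤ) (f : entire) (a b : ZMod 2) :
    antiMap c N F (tDM k f a b) = N a b * F f * signedT c k := by
  simp only [antiMap, tDM, LinearMap.sum_apply, LinearMap.comp_apply, Matrix.entryLinearMap_apply]
  rw [Finset.sum_eq_single a, Finset.sum_eq_single b]
  · rw [Matrix.single_apply_same, DiffOp.lift_tD]
    rfl
  · intro b' _ h
    rw [Matrix.single_apply_of_col_ne _ _ h.symm, map_zero]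
  · simp
  · intro a' _ h
    refine Finset.sum_eq_zero fun b' _ => ?_
    rw [Matrix.single_apply_of_row_ne h.symm, map_zero]
  · simp

/-- The family with prescribed members at `(0,0)`, `(0,1)`, `(1,0)`, `(1,1)`. -/
def block (x₀₀ x₀₁ x₁₀ x₁₁ : SD) (a b : ZMod 2) : SD :=
  if a = 0 then (if b = 0 then x₀₀ else x₀₁) else (if b = 0 then x₁₀ else x₁₁)

/-- `f ↦ f(-D + a) M_0 + f(-D + b) M_1`. -/
def reflect (a b : ℂ) : entire →ₗ[ℂ] SD :=
  Matrix.singleLinearMap ℂ 0 0 ∘ₗ DiffOp.tD 0 ∘ₗ (affComp (-1) a).toLinearMap +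
    Matrix.singleLinearMap ℂ 1 1 ∘ₗ DiffOp.tD 0 ∘ₗ (affComp (-1) b).toLinearMap

/-- The anti-involution `t ↦ -t`, `D ↦ -D - 1 + ∂_θ θ`, `θ ↦ t ∂_θ`, `∂_θ ↦ -t⁻¹ θ`.
It fixes `∂_θ θ` and `θ ∂_θ`, and
`f(-D - 1 + ∂_θ θ) = f(-D) ∂_θ θ + f(-D - 1) θ ∂_θ`. -/
def sigmaZero : SD →ₗ[ℂ] SD :=
  antiMap (-1) (block (M 0 0) (-tDM (-1) 1 1 0) (tDM 1 1 0 1) (M 1 1)) (reflect 0 (-1))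

/-- The anti-involution `t ↦ c t`, `D ↦ -D - 1`, `θ ↦ d θ`, `∂_θ ↦ -d ∂_θ` for signs `c`, `d`.
It exchanges `∂_θ θ` and `θ ∂_θ`. -/
def sigmaSign (c d : ℤˣ) : SD →ₗ[ℂ] SD :=
  antiMap c (block (M 1 1) (-(d : ℤ) • M 0 1) ((d : ℤ) • M 1 0) (M 0 0)) (reflect (-1) (-1))

/-- The fixed subspace `{x | σ x = -x}`. -/
def fixedBy (σ : SD →ₗ[ℂ] SD) : Submodule ℂ SD := LinearMap.ker (σ + LinearMap.id)

/-- The completion `⁰SD^𝒪`. -/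
def SDZero : Submodule ℂ SD := fixedBy sigmaZero

/-- The completions `^{cd}SD^𝒪`, for signs `c`, `d`. -/
def SDSign (c d : ℤˣ) : Submodule ℂ SD := fixedBy (sigmaSign c d)

/-! ### The Lie superalgebra `gl_{∞|∞}` and its subalgebras of types `OSP` and `P` -/

/-- The index `(0, i)` is the integer `i` and `(1, i)` is the half-integer `i - 1/2`; the first
component is the parity. -/
abbrev Idx : Type := ZMod 2 × ℤ

/-- The superspace `ℂ^{∞|∞}` with basis `e_i`, `i ∈ ½ℤ`. -/
abbrev V : Type := Idx →₀ ℂ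

/-- The basis vector `e a i` is `e_i` for `a = 0` and `e_{i - 1/2}` for `a = 1`. -/
def e (a : ZMod 2) (i : ℤ) : V := Finsupp.single (a, i) 1

/-- Vectors of parity `q`. -/
def VParity (q : ZMod 2) : Submodule ℂ V where
  carrier := {v | ∀ i : Idx, i.1 ≠ q → v i = 0}
  add_mem' hv hw i h := by simp [hv i h, hw i h]
  zero_mem' _ _ := rfl
  smul_mem' c v hv i h := by simp [hv i h]

/-- Operators on `ℂ^{∞|∞}` of parity `p`: the matrix entry at `(i, j)` is the coefficient of `e_i`
in the image of `e_j`. -/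
def EndParity (p : ZMod 2) : Submodule ℂ (Module.End ℂ V) where
  carrier := {T | ∀ i j : Idx, i.1 + j.1 ≠ p → T (Finsupp.single j 1) i = 0}
  add_mem' hT hS i j h := by simp [hT i j h, hS i j h]
  zero_mem' _ _ _ := rfl
  smul_mem' c T hT i j h := by simp [hT i j h]

/-- The part of parity `p` of an operator. -/
def endPart (p : ZMod 2) (T : Module.End ℂ V) : Module.End ℂ V :=
  Finsupp.linearCombination ℂ fun j =>
    (T (Finsupp.single j 1)).filter fun i => i.1 + j.1 = p

theorem endPart_single (p : ZMod 2) (T : Module.End ℂ V) (i j : Idx) :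
    endPart p T (Finsupp.single j 1) i =
      if i.1 + j.1 = p then T (Finsupp.single j 1) i else 0 := by
  simp [endPart, Finsupp.filter_apply]

theorem end_ext {T S : Module.End ℂ V}
    (h : ∀ i j, T (Finsupp.single j 1) i = S (Finsupp.single j 1) i) : T = S := by
  refine Finsupp.lhom_ext' fun j => LinearMap.ext_ring ?_
  ext i
  exact h i j

instance : GradedAlgebra EndParity where
  one_mem i j h := by
    refine Finsupp.single_eq_of_ne ?_
    rintro rfl
    exact h (CharTwo.add_self_eq_zero _)
  mul_mem p q T S hT hS i j h := by
    change T (S (Finsupp.single j 1)) i = 0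
    generalize hv : S (Finsupp.single j 1) = v
    rw [← Finsupp.sum_single v, Finsupp.sum, map_sum, Finsupp.finsetSum_apply]
    refine Finset.sum_eq_zero fun k _ => ?_
    rw [← mul_one (v k), ← smul_eq_mul, ← Finsupp.smul_single, map_smul, Finsupp.smul_apply]
    by_cases h1 : i.1 + k.1 = p
    · have h2 : k.1 + j.1 ≠ q := by
        rintro rfl
        apply h
        rw [← h1, add_assoc, ← add_assoc k.1, CharTwo.add_self_eq_zero, zero_add]
      rw [← hv, hS k j h2, zero_smul]
    · rw [hT i k h1, smul_zero]
  toDecomposition := decompositionOfParts (A := Module.End ℂ V) EndParity endPart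
    (fun p T i j h => (endPart_single p T i j).trans (if_neg h))
    (fun p T S => end_ext fun i j => by
      simp only [endPart_single, LinearMap.add_apply, Finsupp.add_apply]
      split_ifs <;> simp)
    (fun T => end_ext fun i j => by
      simp [LinearMap.sum_apply, Finsupp.finsetSum_apply, endPart_single])
    (fun p T hT q => end_ext fun i j => by
      rw [endPart_single]
      by_cases h : i.1 + j.1 = p
      · by_cases h' : q = p
        · simp [h, h']
        · simp [h, h', Ne.symm h']
      · by_cases h' : q = p <;> simp [h', hT i j h])

/-- `gl_{∞|∞}`: the operators on `ℂ^{∞|∞}` whose matrix is supported in a band around the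
diagonal. -/
def gl : Submodule ℂ (Module.End ℂ V) where
  carrier := {T | ∃ N : ℤ, ∀ i j : Idx, N < |i.2 - j.2| → T (Finsupp.single j 1) i = 0}
  add_mem' := by
    rintro T S ⟨N, hN⟩ ⟨N', hN'⟩
    refine ⟨max N N', fun i j h => ?_⟩
    rw [LinearMap.add_apply, Finsupp.add_apply, hN i j (lt_of_le_of_lt (le_max_left _ _) h),
      hN' i j (lt_of_le_of_lt (le_max_right _ _) h), add_zero]
  zero_mem' := ⟨0, fun _ _ _ => rfl⟩
  smul_mem' := by
    rintro c T ⟨N, hN⟩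
    exact ⟨N, fun i j h => by rw [LinearMap.smul_apply, Finsupp.smul_apply, hN i j h, smul_zero]⟩

/-- The bilinear form on `ℂ^{∞|∞}` with prescribed values on the basis. -/
def formOf (G : Idx → Idx → ℂ) : V →ₗ[ℂ] V →ₗ[ℂ] ℂ :=
  Finsupp.linearCombination ℂ fun i => Finsupp.linearCombination ℂ (G i)

/-- The Lie superalgebra of the `T ∈ gl_{∞|∞}` whose homogeneous parts `T_p` preserve the form:
`(T_p v | w) = -(-1)^{p|v|} (v | T_p w)`. -/
def preserving (β : V →ₗ[ℂ] V →ₗ[ℂ] ℂ) : Submodule ℂ (Module.End ℂ V) where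
  carrier := {T | T ∈ gl ∧ ∀ p q : ZMod 2, ∀ v ∈ VParity q, ∀ w : V,
    β ((decompose EndParity T p : Module.End ℂ V) v) w =
      -(superSign p q * β v ((decompose EndParity T p : Module.End ℂ V) w))}
  add_mem' := by
    rintro T S ⟨hT, hT'⟩ ⟨hS, hS'⟩
    refine ⟨gl.add_mem hT hS, fun p q v hv w => ?_⟩
    simp only [decompose_add, DirectSum.add_apply, Submodule.coe_add, LinearMap.add_apply, map_add,
      hT' p q v hv w, hS' p q v hv w]
    ring
  zero_mem' := ⟨gl.zero_mem, fun p q v hv w => by simp⟩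
  smul_mem' := by
    rintro c T ⟨hT, hT'⟩
    refine ⟨gl.smul_mem c hT, fun p q v hv w => ?_⟩
    simp only [decompose_smul, DirectSum.smul_apply, Submodule.coe_smul, LinearMap.smul_apply,
      map_smul, hT' p q v hv w, smul_eq_mul]
    ring

/-- The even super-symmetric form `(e_i | e_j) = (-1)^i δ_{i,-j}` for integers and
`(e_r | e_s) = (-1)^{r + 1/2} δ_{r,-s}` for half-integers; with `r = i - 1/2` and `s = j - 1/2` the
latter is `(-1)^i δ_{i+j,1}`. -/
def formOSP : V →ₗ[ℂ] V →ₗ[ℂ] ℂ :=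
  formOf fun x y =>
    if x.1 = 0 ∧ y.1 = 0 ∧ x.2 + y.2 = 0 then (-1) ^ x.2
    else if x.1 = 1 ∧ y.1 = 1 ∧ x.2 + y.2 = 1 then (-1) ^ x.2
    else 0

/-- The Lie superalgebra `𝓑` of type `OSP`. -/
def ospB : Submodule ℂ (Module.End ℂ V) := preserving formOSP

/-- The odd form `(e_i | e_{j - 1/2}) = c^i δ_{i+j,1}`, `(e_{j - 1/2} | e_i) = ε (e_i | e_{j - 1/2})`:
symmetric for `ε = 1` and skew-symmetric for `ε = -1`. -/
def formOdd (c ε : ℤˣ) : V →ₗ[ℂ] V →ₗ[ℂ] ℂ :=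
  formOf fun x y =>
    if x.1 = 0 ∧ y.1 = 1 ∧ x.2 + y.2 = 1 then ((c ^ x.2 : ℤˣ) : ℤ)
    else if x.1 = 1 ∧ y.1 = 0 ∧ x.2 + y.2 = 1 then ((ε * c ^ y.2 : ℤˣ) : ℤ)
    else 0

/-- The Lie superalgebras `𝓟_{cd}` of type `P`.  It contains
`E_{ij} M_1 - c^{i+j} E_{1-j,1-i} M_0`, `(E_{ij} - d c^{i+j} E_{1-j,1-i}) M_-` and
`(E_{ij} + d c^{i+j} E_{1-j,1-i}) M_+`.  Thus the form is symmetric for `++` and `--` and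
skew-symmetric for `+-` and `-+`. -/
def typeP (c d : ℤˣ) : Submodule ℂ (Module.End ℂ V) := preserving (formOdd c (c * d))

/-! ### The embeddings `φ_s` -/

/-- The action of `t^k f(D) M_{ab}` on `ℂ^{∞|∞} = t^s ℂ[t,t⁻¹] ⊕ θ t^s ℂ[t,t⁻¹]`, where
`e_i = t^{-i+s}` and `e_{i-1/2} = t^{-i+s} θ`; this is `∑_j f(-j + s) E_{j-k,j} M_{ab}`. -/
def phiTerm (s : ℂ) (a b : ZMod 2) (k : ℤ) : entire →ₗ[ℂ] Module.End ℂ V where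
  toFun f := Finsupp.linearCombination ℂ fun j =>
    if j.1 = b then f.1 (-j.2 + s) • e a (j.2 - k) else 0
  map_add' f g := end_ext fun i j => by
    by_cases h : j.1 = b <;> simp [h, add_mul]
  map_smul' c f := end_ext fun i j => by
    by_cases h : j.1 = b <;> simp [h, mul_assoc]

/-- The embedding `φ_s`. -/
def phi (s : ℂ) : SD →ₗ[ℂ] Module.End ℂ V :=
  ∑ a : ZMod 2, ∑ b : ZMod 2,
    DiffOp.lift (phiTerm s a b) ∘ₗ Matrix.entryLinearMap ℂ DiffOp a b

/-! ### The kernels -/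

/-- `I_s`: the entire functions vanishing on `s + ℤ`. -/
def I (s : ℂ) : Set entire := {f | ∀ n : ℤ, f.1 (n + s) = 0}

/-- `𝒪^{(j)}`: even functions for even `j`, odd functions for odd `j`. -/
def entireParity (j : ℤ) : Set entire := {f | ∀ w, f.1 (-w) = (-1) ^ j * f.1 w}

/-- `I^{(j)}_{s,k}`: the functions in `𝒪^{(j)}` vanishing on `s + k/2 + ℤ`. -/
def IParity (j : ℤ) (s : ℂ) (k : ℤ) : Set entire :=
  {f | f ∈ entireParity j ∧ ∀ n : ℤ, f.1 (n + k / 2 + s) = 0}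

/-- `⁰J_s`, the span over all `k` of `t^k f_0(D + k/2) M_0`, `t^k f_1(D + (k+1)/2) M_1` and
`(-t)^k g(-D - k) M_+ + t^{k-1} g(D) M_-`.  Both `g(D)` and `g(-D - k)` have to vanish on `s + ℤ`,
which means `g ∈ I_s ∩ I_{-s}`. -/
def JZero (s : ℂ) : Submodule ℂ SD :=
  Submodule.span ℂ (⋃ k : ℤ,
    {x | ∃ f ∈ IParity (k + 1) s k, x = tDM k (affComp 1 (k / 2) f) 0 0} ∪
    {x | ∃ f ∈ IParity (k + 1) s (k + 1), x = tDM k (affComp 1 ((k + 1) / 2) f) 1 1} ∪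
    {x | ∃ g ∈ I s ∩ I (-s),
      x = (((-1) ^ k : ℤˣ) : ℤ) • tDM k (affComp (-1) (-k) g) 0 1 + tDM (k - 1) g 1 0})

/-- The parity `j` for which `(-1)^j` is the given sign. -/
def signExp (c : ℤˣ) : ℤ := if c = 1 then 0 else 1

/-- `^{cd}J_s`, the span over all `k` of `t^k (f(D) M_0 - c^k f(-D - k - 1) M_1)`,
`t^{k-1} f_-(D + k/2) M_-` and `t^k f_+(D + (k+1)/2) M_+`, where `f ∈ I_s ∩ I_{-s}`, `f_- ∈ I^{(j)}_{s,k}` with `(-1)^j = -d c^{k+1}` and `f_+ ∈ I^{(j)}_{s,k+1}` with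
`(-1)^j = d c^k`. -/
def JSign (c d : ℤˣ) (s : ℂ) : Submodule ℂ SD :=
  Submodule.span ℂ (⋃ k : ℤ,
    {x | ∃ f ∈ I s ∩ I (-s),
      x = tDM k f 0 0 - ((c ^ k : ℤˣ) : ℤ) • tDM k (affComp (-1) (-k - 1) f) 1 1} ∪
    {x | ∃ f ∈ IParity (signExp (-d * c ^ (k + 1))) s k, x = tDM (k - 1) (affComp 1 (k / 2) f) 1 0} ∪
    {x | ∃ f ∈ IParity (signExp (d * c ^ k)) s (k + 1),
      x = tDM k (affComp 1 ((k + 1) / 2) f) 0 1})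

/-- The sequence `0 ⟶ J ⟶ L ⟶ G ⟶ 0` given by the inclusion and by `φ_s` is a short exact sequence
of Lie superalgebras, for `J ⊆ L ⊆ SD^𝒪` and `G ⊆ gl_{∞|∞}`. -/
def PhiShortExact (s : ℂ) (J L : Submodule ℂ SD) (G : Submodule ℂ (Module.End ℂ V)) : Prop :=
  IsShortExact (A := SD) (B := Module.End ℂ V) SDParity EndParity J L (phi s) G

end SuperCircle

end

namespace SuperCircle

open Filter Topology

/-! ### Interpolation by entire functions -/

/-! The map `phi s` is an even homomorphism of associative superalgebras, so it respects
super-brackets. The elements with `σ x = -x` form a Lie subsuperalgebra because `σ` is an even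
anti-homomorphism. Exactness thus reduces to computing the kernel and the image of `phi s` on
`fixedBy σ`. Both are controlled by one fact: the matrix entries of `phi s x` are the values of the
coefficients of `x` on `s + ℤ` (`phi_apply_coeff`).

All the anti-involutions have the shape `IsReflection`: up to signs, shifts of the power of `t` and
a permutation of matrix units, they replace `f(w)` by `f(-w - integer)`. Hence `σ` carries `ker φ_s`
into `ker φ_{-s}`.

Kernel: if `σ x = -x` and `φ_s x = 0`, then also `φ_{-s} x = 0`, so every coefficient lies in `I s ∩
I (-s)`. Since `x = (x - σ x)/2`, the kernel is spanned by the antisymmetrised monomials, and these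
are the listed generators of `J`. An entry whose slot is preserved by `σ` gives an even or odd
function about a half-integer centre; slots that are exchanged give two-term generators.

Image for `s ∉ ½ℤ`: the sets `s + ℤ` and `-s + ℤ` are disjoint, so entire interpolation lifts any
band matrix `T` to some `x` with `φ_s x = T` and `φ_{-s} x = 0`; then `x - σ x` is a lift in
`fixedBy σ`. Image for `s = 0`: here `σ` is the super-adjoint for the given form. Thus fixed
elements preserve the form; conversely, for any lift `x` of a form-preserving `T`, nondegeneracy
forces `φ_0 (σ x) = -T`, and `(x - σ x)/2` lifts `T`. -/

/-- A polynomial vanishing at the earlier points is multiplied by `(z / p n) ^ m`. This factor is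
`1` at `p n` and at most `2⁻ᵐ` on the disc of radius `‖p n‖ / 2`, so a large `m` makes the product
small there. -/
theorem exists_entire_small_of_vanishing (p : ℕ → ℂ) (hp : Function.Injective p) (n : ℕ) (b : ℂ) :
    ∃ g : ℂ → ℂ, Differentiable ℂ g ∧ (∀ j < n, g (p j) = 0) ∧ g (p n) = b ∧
      ∀ z, ‖z‖ < ‖p n‖ / 2 → ‖g z‖ ≤ (1 / 2) ^ n := by
  set P : ℂ → ℂ := fun z => ∏ j ∈ Finset.range n, (z - p j) with hP
  have hPd : Differentiable ℂ P := by
    rw [hP]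
    fun_prop
  have hPn : P (p n) ≠ 0 := Finset.prod_ne_zero_iff.2 fun j hj =>
    sub_ne_zero.2 fun h => (Finset.mem_range.1 hj).ne' (hp h)
  have hP0 : ∀ j < n, P (p j) = 0 := fun j hj =>
    Finset.prod_eq_zero (Finset.mem_range.2 hj) (sub_self _)
  -- When `p n = 0` the factor `z / p n` is unavailable, but the disc is then empty and no smallness
  -- is needed.
  by_cases h0 : p n = 0
  · refine ⟨fun z => b / P (p n) * P z, hPd.const_mul _, fun j hj => by simp [hP0 j hj],
      div_mul_cancel₀ _ hPn, fun z hz => ?_⟩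
    rw [h0, norm_zero, zero_div] at hz
    exact absurd hz (norm_nonneg z).not_gt
  obtain ⟨B, hB⟩ := (isCompact_closedBall (0 : ℂ) (‖p n‖ / 2)).exists_bound_of_continuousOn
    (hPd.const_mul (b / P (p n))).continuous.continuousOn
  obtain ⟨m, hm⟩ : ∃ m : ℕ, |B| * (1 / 2) ^ m < (1 / 2 : ℝ) ^ n := by
    have h : Tendsto (fun m : ℕ => |B| * (1 / 2 : ℝ) ^ m) atTop (𝓝 (|B| * 0)) :=
      (tendsto_pow_atTop_nhds_zero_of_lt_one (by norm_num) (by norm_num)).const_mul _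
    rw [mul_zero] at h
    exact (h.eventually (gt_mem_nhds (by positivity))).exists
  refine ⟨fun z => b / P (p n) * P z * (z / p n) ^ m,
    (hPd.const_mul _).mul ((differentiable_id.div_const _).pow m), fun j hj => by simp [hP0 j hj],
    ?_, fun z hz => ?_⟩
  · simp only [div_self h0, one_pow, mul_one]
    exact div_mul_cancel₀ _ hPn
  · have h1 : ‖z / p n‖ ≤ 1 / 2 := by
      rw [norm_div, div_le_iff₀ (norm_pos_iff.2 h0)]
      linarith
    rw [norm_mul, norm_pow]
    refine (mul_le_mul ((hB z ?_).trans (le_abs_self B)) (pow_le_pow_left₀ (norm_nonneg _) h1 m)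
      (by positivity) (abs_nonneg B)).trans hm.le
    simpa using hz.le

/-- A discrete sequence of points can be interpolated by an entire function. -/
theorem exists_entire_interpolation (p : ℕ → ℂ) (hp : Function.Injective p)
    (hlim : Tendsto (fun n => ‖p n‖) atTop atTop) (a : ℕ → ℂ) :
    ∃ f : ℂ → ℂ, Differentiable ℂ f ∧ ∀ n, f (p n) = a n := by
  choose g hgd hg0 hgn hgs using exists_entire_small_of_vanishing p hp
  -- `S n` is the `n`-th partial sum. Each new term corrects the error left at `p n` and, vanishing
  -- at the earlier points, keeps the values already reached.
  let S : ℕ → ℂ → ℂ := fun n => Nat.rec 0 (fun n s => s + g n (a n - s (p n))) n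
  set F : ℕ → ℂ → ℂ := fun n => g n (a n - S n (p n)) with hF
  have hS : ∀ n z, S n z = ∑ j ∈ Finset.range n, F j z := by
    intro n z
    induction n with
    | zero => rfl
    | succ n ih => rw [Finset.sum_range_succ, ← ih]; rfl
  have hFd : ∀ n, Differentiable ℂ (F n) := fun n => hgd _ _
  refine ⟨fun z => ∑' n, F n z, fun z => ?_, fun n => ?_⟩
  · obtain ⟨N, hN⟩ := (hlim.eventually_gt_atTop (2 * (‖z‖ + 1))).exists_forall_of_atTop
    have hle : ∀ n w, w ∈ Metric.ball (0 : ℂ) (‖z‖ + 1) → ‖F (n + N) w‖ ≤ (1 / 2) ^ (n + N) := by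
      intro n w hw
      rw [mem_ball_zero_iff] at hw
      refine hgs _ _ w ?_
      linarith [hN (n + N) (Nat.le_add_left N n)]
    have hu : Summable fun n : ℕ => (1 / 2 : ℝ) ^ (n + N) := by
      simp_rw [pow_add]
      exact (summable_geometric_of_lt_one (by norm_num) (by norm_num)).mul_right _
    have hd := Complex.differentiableOn_tsum_of_summable_norm hu
      (fun n => (hFd (n + N)).differentiableOn) Metric.isOpen_ball hle
    have hmem : Metric.ball (0 : ℂ) (‖z‖ + 1) ∈ 𝓝 z :=
      Metric.isOpen_ball.mem_nhds (by simp)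
    have hfin : Differentiable ℂ fun w => ∑ j ∈ Finset.range N, F j w :=
      Differentiable.fun_sum fun j _ => hFd j
    refine ((hfin z).add (hd.differentiableAt hmem)).congr_of_eventuallyEq ?_
    filter_upwards [hmem] with w hw
    have hsum : Summable fun n => F n w :=
      (summable_nat_add_iff N).1 (Summable.of_norm_bounded hu fun n => hle n w hw)
    exact (hsum.sum_add_tsum_nat_add N).symm
  · have h1 : ∑' m, F m (p n) = ∑ m ∈ Finset.range (n + 1), F m (p n) :=
      tsum_eq_sum fun m hm => hg0 m _ n (by simpa [Nat.lt_succ_iff] using hm)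
    refine h1.trans ?_
    rw [Finset.sum_range_succ, ← hS]
    simp [hF, hgn]

theorem exists_entire_interpolation_int (s : ℂ) (a : ℤ → ℂ) :
    ∃ f : entire, ∀ n : ℤ, f.1 (n + s) = a n := by
  let u := (Denumerable.eqv ℤ).symm
  have hlim : Tendsto (fun n : ℤ => ‖(n : ℂ) + s‖) cofinite atTop := by
    refine tendsto_atTop_mono (f := fun n : ℤ => ‖(n : ℝ)‖ - ‖s‖) (fun n => ?_) ?_
    · have h := norm_sub_le_norm_add (n : ℂ) s
      simpa using h
    · refine tendsto_atTop_add_const_right _ _ ?_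
      exact (tendsto_norm_cocompact_atTop (E := ℝ)).comp Int.tendsto_coe_cofinite
  obtain ⟨f, hf, h⟩ := exists_entire_interpolation (fun n => (u n : ℂ) + s)
    (fun m n h => u.injective (by exact_mod_cast add_right_cancel h))
    (by rw [← Nat.cofinite_eq_atTop]; exact hlim.comp u.injective.tendsto_cofinite)
    (fun n => a (u n))
  refine ⟨⟨f, hf⟩, fun n => ?_⟩
  have := h (u.symm n)
  simpa using this

/-- The function `sin π(w + s)` vanishes exactly on `-s + ℤ`, and `2s ∉ ℤ` keeps it nonzero on `s +
ℤ`. Interpolating the quotients and multiplying back gives the required function. -/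
theorem exists_entire_interpolation_vanishing {s : ℂ} (hs : ∀ n : ℤ, s ≠ n / 2) (a : ℤ → ℂ) :
    ∃ f ∈ I (-s), ∀ n : ℤ, f.1 (n + s) = a n := by
  let h : entire := ⟨fun w => Complex.sin (Real.pi * (w + s)), by
    change Differentiable ℂ _
    fun_prop⟩
  have hh : ∀ n : ℤ, h.1 (n + s) ≠ 0 := fun n h0 => by
    obtain ⟨k, hk⟩ := Complex.sin_eq_zero_iff.1 h0
    have hpi : (Real.pi : ℂ) ≠ 0 := by exact_mod_cast Real.pi_ne_zero
    rw [mul_comm (k : ℂ)] at hk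
    have := mul_left_cancel₀ hpi hk
    refine hs (k - n) ?_
    push_cast
    linear_combination this / 2
  obtain ⟨g, hg⟩ := exists_entire_interpolation_int s fun n => a n / h.1 (n + s)
  refine ⟨g * h, fun n => ?_, fun n => ?_⟩
  · have h0 : h.1 (n + -s) = 0 := Complex.sin_eq_zero_iff.2 ⟨n, by ring⟩
    change g.1 _ * h.1 _ = 0
    rw [h0, mul_zero]
  · change g.1 _ * h.1 _ = _
    rw [hg, div_mul_cancel₀ _ (hh n)]

open DirectSum

/-! ### Even maps and anti-homomorphisms of associative superalgebras -/

theorem superSign_mul_self (p q : ZMod 2) : superSign p q * superSign p q = 1 := by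
  rw [superSign, ← mul_pow]
  simp

theorem superSign_comm (p q : ZMod 2) : superSign p q = superSign q p := by
  rw [superSign, superSign, mul_comm]

section Super

variable {A B : Type} [Ring A] [Algebra ℂ A] {𝒜 : ZMod 2 → Submodule ℂ A} [GradedAlgebra 𝒜]
  [Ring B] [Algebra ℂ B] {ℬ : ZMod 2 → Submodule ℂ B} [GradedAlgebra ℬ]

theorem decompose_map_apply {φ : A →ₗ[ℂ] B} (hφ : ∀ p, ∀ x ∈ 𝒜 p, φ x ∈ ℬ p) (x : A)
    (p : ZMod 2) : (decompose ℬ (φ x) p : B) = φ (decompose 𝒜 x p) := by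
  classical
  conv_lhs => rw [← sum_support_decompose 𝒜 x]
  rw [map_sum, decompose_sum, DFinsupp.finsetSum_apply, AddSubmonoidClass.coe_finsetSum]
  by_cases hp : p ∈ (decompose 𝒜 x).support
  · rw [Finset.sum_eq_single_of_mem p hp fun q _ hq =>
        decompose_of_mem_ne ℬ (hφ q _ (decompose 𝒜 x q).2) hq,
      decompose_of_mem_same ℬ (hφ p _ (decompose 𝒜 x p).2)]
  · rw [DFinsupp.notMem_support_iff.1 hp, ZeroMemClass.coe_zero, map_zero]
    refine Finset.sum_eq_zero fun q hq => decompose_of_mem_ne ℬ (hφ q _ (decompose 𝒜 x q).2) ?_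
    rintro rfl
    exact hp hq

theorem map_superBracket {φ : A →ₗ[ℂ] B} (hφ : ∀ p, ∀ x ∈ 𝒜 p, φ x ∈ ℬ p)
    (hmul : ∀ x y, φ (x * y) = φ x * φ y) (x y : A) :
    φ (superBracket 𝒜 x y) = superBracket ℬ (φ x) (φ y) := by
  simp only [superBracket, map_sum, map_sub, map_smul, hmul, decompose_map_apply hφ]

theorem superBracket_zero_right (x : A) : superBracket 𝒜 x 0 = 0 := by
  simp [superBracket]

/-- An even `σ` commutes with taking homogeneous parts, so the subspace is graded. For homogeneous
`x`, `y` in it, with `ε = superSign p q`, `σ` sends `xy` to `ε yx` and `yx` to `ε xy`; since `ε² =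
1`, the bracket `xy - ε yx` changes sign. -/
theorem isLieSubsuperalgebra_ker_add_id {σ : A →ₗ[ℂ] A} (hσ : ∀ p, ∀ x ∈ 𝒜 p, σ x ∈ 𝒜 p)
    (hanti : ∀ p q, ∀ x ∈ 𝒜 p, ∀ y ∈ 𝒜 q, σ (x * y) = superSign p q • (σ y * σ x)) :
    IsLieSubsuperalgebra 𝒜 (LinearMap.ker (σ + LinearMap.id)) := by
  have hfix : ∀ x, x ∈ LinearMap.ker (σ + LinearMap.id) ↔ σ x = -x := fun x => by
    rw [LinearMap.mem_ker, LinearMap.add_apply, LinearMap.id_apply, add_eq_zero_iff_eq_neg]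
  have hgr : ∀ x ∈ LinearMap.ker (σ + LinearMap.id), ∀ p,
      σ (decompose 𝒜 x p) = -(decompose 𝒜 x p : A) := fun x hx p => by
    rw [← decompose_map_apply hσ, (hfix x).1 hx, decompose_neg]
    rfl
  refine ⟨fun x hx p => (hfix _).2 (hgr x hx p), fun x hx y hy => (hfix _).2 ?_⟩
  simp only [superBracket, map_sum, map_sub, map_smul, ← Finset.sum_neg_distrib]
  refine Finset.sum_congr rfl fun p _ => Finset.sum_congr rfl fun q _ => ?_
  rw [hanti p q _ (decompose 𝒜 x p).2 _ (decompose 𝒜 y q).2,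
    hanti q p _ (decompose 𝒜 y q).2 _ (decompose 𝒜 x p).2, hgr x hx, hgr y hy, superSign_comm q p,
    smul_smul, superSign_mul_self, one_smul, neg_mul_neg, neg_mul_neg, neg_sub]

theorem IsLieSubsuperalgebra.map {L : Submodule ℂ A} (hL : IsLieSubsuperalgebra 𝒜 L)
    {φ : A →ₗ[ℂ] B} (hφ : ∀ p, ∀ x ∈ 𝒜 p, φ x ∈ ℬ p) (hmul : ∀ x y, φ (x * y) = φ x * φ y) :
    IsLieSubsuperalgebra ℬ (L.map φ) := by
  constructor
  · rintro _ ⟨x, hx, rfl⟩ p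
    exact ⟨_, hL.graded x hx p, (decompose_map_apply hφ x p).symm⟩
  · rintro _ ⟨x, hx, rfl⟩ _ ⟨y, hy, rfl⟩
    exact ⟨_, hL.bracket_mem x hx y hy, map_superBracket hφ hmul x y⟩

theorem IsLieSubsuperalgebra.isLieSuperideal_inf_ker {L : Submodule ℂ A}
    (hL : IsLieSubsuperalgebra 𝒜 L) {φ : A →ₗ[ℂ] B} (hφ : ∀ p, ∀ x ∈ 𝒜 p, φ x ∈ ℬ p)
    (hmul : ∀ x y, φ (x * y) = φ x * φ y) :
    IsLieSuperideal 𝒜 (L ⊓ LinearMap.ker φ) L where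
  le := inf_le_left
  graded x hx p := ⟨hL.graded x hx.1 p, by
    have h : φ x = 0 := hx.2
    rw [SetLike.mem_coe, LinearMap.mem_ker, ← decompose_map_apply hφ, h]
    simp⟩
  bracket_mem x hx y hy := ⟨hL.bracket_mem x hx y hy.1, by
    have h : φ y = 0 := hy.2
    rw [SetLike.mem_coe, LinearMap.mem_ker, map_superBracket hφ hmul, h, superBracket_zero_right]⟩

/-- An even multiplicative map makes every clause automatic except the identification of the kernel
and the image. -/
theorem IsLieSubsuperalgebra.isShortExact {L : Submodule ℂ A} (hL : IsLieSubsuperalgebra 𝒜 L)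
    {φ : A →ₗ[ℂ] B} (hφ : ∀ p, ∀ x ∈ 𝒜 p, φ x ∈ ℬ p) (hmul : ∀ x y, φ (x * y) = φ x * φ y)
    {J : Submodule ℂ A} {G : Submodule ℂ B} (hJ : L ⊓ LinearMap.ker φ = J) (hG : L.map φ = G) :
    IsShortExact 𝒜 ℬ J L φ G where
  source := hL
  target := hG ▸ hL.map hφ hmul
  ideal := hJ ▸ hL.isLieSuperideal_inf_ker hφ hmul
  map_parity p x _ := hφ p x
  map_bracket x _ y _ := map_superBracket hφ hmul x y
  kernel := hJ
  range := hG

end Super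

/-! ### Generators of `SD^𝒪` -/

theorem tDM_add (k : ℤ) (f g : entire) (a b : ZMod 2) :
    tDM k (f + g) a b = tDM k f a b + tDM k g a b := by
  rw [tDM, map_add, Matrix.single_add]; rfl

theorem tDM_smul (k : ℤ) (c : ℂ) (f : entire) (a b : ZMod 2) :
    tDM k (c • f) a b = c • tDM k f a b := by
  rw [tDM, map_smul, ← Matrix.smul_single]; rfl

theorem tDM_mul_tDM (k l : ℤ) (f g : entire) (a b c : ZMod 2) :
    tDM k f a b * tDM l g b c = tDM (k + l) (affComp 1 l f * g) a c := by
  rw [tDM, tDM, Matrix.single_mul_single_same, DiffOp.tD_mul_tD]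
  rfl

theorem tDM_mul_tDM_of_ne (k l : ℤ) (f g : entire) (a : ZMod 2) {b b' : ZMod 2} (c : ZMod 2)
    (h : b ≠ b') : tDM k f a b * tDM l g b' c = 0 :=
  Matrix.single_mul_single_of_ne _ _ _ _ h _

theorem tDM_mem_SDParity (k : ℤ) (f : entire) (a b : ZMod 2) : tDM k f a b ∈ SDParity (a + b) := by
  intro i j h
  refine Matrix.single_apply_of_ne _ _ _ _ _ ?_
  rintro ⟨rfl, rfl⟩
  exact h rfl

/-- The coefficient `f_k` of `∑_k t^k f_k(D)`. -/
noncomputable def DiffOp.coeff (k : ℤ) : DiffOp →ₗ[ℂ] entire := Finsupp.lapply k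

theorem DiffOp.coeff_tD_same (k : ℤ) (f : entire) : DiffOp.coeff k (DiffOp.tD k f) = f :=
  Finsupp.single_eq_same

theorem DiffOp.coeff_tD_of_ne {k l : ℤ} (h : k ≠ l) (f : entire) :
    DiffOp.coeff k (DiffOp.tD l f) = 0 :=
  Finsupp.single_eq_of_ne h

theorem DiffOp.exists_sum_tD_coeff (x : DiffOp) :
    ∃ S : Finset ℤ, x = ∑ k ∈ S, DiffOp.tD k (DiffOp.coeff k x) :=
  ⟨Finsupp.support x, (Finsupp.sum_single (M := entire) x).symm⟩

theorem single_mem_of_tDM_mem {p : SD → Prop} (zero : p 0) (add : ∀ x y, p x → p y → p (x + y))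
    {a b : ZMod 2} (x : DiffOp) (tDM : ∀ k, p (tDM k (DiffOp.coeff k x) a b)) :
    p (Matrix.single a b x) := by
  obtain ⟨S, hS⟩ := x.exists_sum_tD_coeff
  have h : Matrix.single a b x = ∑ k ∈ S, SuperCircle.tDM k (DiffOp.coeff k x) a b := by
    conv_lhs => rw [hS]
    exact map_sum (Matrix.singleAddMonoidHom a b) _ _
  rw [h]
  exact Finset.sum_induction _ p add zero fun k _ => tDM k

/-- The coefficient of `t^k M_{ab}`. -/
noncomputable def coeff (a b : ZMod 2) (k : ℤ) : SD →ₗ[ℂ] entire :=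
  DiffOp.coeff k ∘ₗ Matrix.entryLinearMap ℂ DiffOp a b

theorem coeff_tDM (a b a' b' : ZMod 2) (k l : ℤ) (f : entire) :
    coeff a b k (tDM l f a' b') = if a' = a ∧ b' = b ∧ l = k then f else 0 := by
  simp only [coeff, tDM, LinearMap.comp_apply, Matrix.entryLinearMap_apply]
  by_cases h : a' = a ∧ b' = b
  · obtain ⟨rfl, rfl⟩ := h
    rw [Matrix.single_apply_same]
    by_cases hk : l = k
    · subst hk
      simp [DiffOp.coeff_tD_same]
    · simp [DiffOp.coeff_tD_of_ne (Ne.symm hk), hk]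
  · rw [Matrix.single_apply_of_ne _ _ _ _ _ h, if_neg (fun h' => h ⟨h'.1, h'.2.1⟩), map_zero]

/-- The monomials carry the actual coefficients of `x`, so information about `x`, such as its
coefficients lying in `I s`, remains available in the induction step. -/
theorem SD_induction {p : SD → Prop} (zero : p 0) (add : ∀ x y, p x → p y → p (x + y)) (x : SD)
    (tDM : ∀ a b k, x a b ≠ 0 → p (tDM k (coeff a b k x) a b)) : p x := by
  rw [Matrix.matrix_eq_sum_single x]
  refine Finset.sum_induction _ p add zero fun a _ => Finset.sum_induction _ p add zero fun b _ => ?_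
  by_cases h : x a b = 0
  · rw [h, Matrix.single_zero]
    exact zero
  · exact single_mem_of_tDM_mem zero add _ fun k => tDM a b k h

theorem SDParity_induction {p : SD → Prop} (q : ZMod 2) (zero : p 0)
    (add : ∀ x y, p x → p y → p (x + y)) (tDM : ∀ a b k f, a + b = q → p (tDM k f a b))
    (x : SD) (hx : x ∈ SDParity q) : p x :=
  SD_induction zero add x fun a b k h => tDM a b k _ (by
    by_contra h'
    exact h (hx a b h'))

/-! ### The homomorphism `φ_s` -/

theorem phi_tDM (s : ℂ) (k : ℤ) (f : entire) (a b : ZMod 2) :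
    phi s (tDM k f a b) = phiTerm s a b k f := by
  simp only [phi, tDM, LinearMap.sum_apply, LinearMap.comp_apply, Matrix.entryLinearMap_apply]
  rw [Finset.sum_eq_single a, Finset.sum_eq_single b]
  · rw [Matrix.single_apply_same, DiffOp.lift_tD]
  · intro b' _ h
    rw [Matrix.single_apply_of_col_ne _ _ h.symm, map_zero]
  · simp
  · intro a' _ h
    refine Finset.sum_eq_zero fun b' _ => ?_
    rw [Matrix.single_apply_of_row_ne h.symm, map_zero]
  · simp

theorem phi_tDM_single (s : ℂ) (k : ℤ) (f : entire) (a b c : ZMod 2) (j : ℤ) :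
    phi s (tDM k f a b) (e c j) = if c = b then f.1 (-j + s) • e a (j - k) else 0 := by
  rw [phi_tDM]
  simp [phiTerm, e]

theorem end_ext_e {T S : Module.End ℂ V} (h : ∀ c j, T (e c j) = S (e c j)) : T = S :=
  end_ext fun i j => congrArg (fun v : V => v i) (h j.1 j.2)

theorem phi_mul (s : ℂ) (x y : SD) : phi s (x * y) = phi s x * phi s y := by
  refine SD_induction (p := fun x => phi s (x * y) = phi s x * phi s y) (by simp)
    (fun x x' h h' => by simp only [add_mul, map_add, h, h']) x fun a b k _ => ?_
  generalize coeff a b k x = f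
  refine SD_induction (p := fun y => phi s (tDM k f a b * y) = phi s (tDM k f a b) * phi s y)
    (by simp) (fun x x' h h' => by simp only [mul_add, map_add, h, h']) y fun b' c l _ => ?_
  generalize coeff b' c l y = g
  refine end_ext_e fun i j => ?_
  rw [Module.End.mul_apply, phi_tDM_single]
  by_cases hi : i = c
  · by_cases hb : b = b'
    · subst hb
      rw [tDM_mul_tDM, phi_tDM_single, if_pos hi, if_pos hi, map_smul, phi_tDM_single, if_pos rfl,
        smul_smul, sub_sub, add_comm l k]
      congr 1
      -- `t^l` moves `e_j` to `e_{j-l}` and raises the eigenvalue of `D` by `l`; this is the shift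
      -- in the product rule of `DiffOp`.
      have h : 1 * (-(j : ℂ) + s) + l = -((j - l : ℤ) : ℂ) + s := by
        push_cast
        ring
      change f.1 (1 * (-(j : ℂ) + s) + l) * g.1 _ = _
      rw [mul_comm, h]
    · rw [tDM_mul_tDM_of_ne _ _ _ _ _ _ hb, if_pos hi, map_smul, phi_tDM_single,
        if_neg (Ne.symm hb), smul_zero, map_zero]
      rfl
  · rw [if_neg hi, map_zero]
    by_cases hb : b = b'
    · subst hb
      rw [tDM_mul_tDM, phi_tDM_single, if_neg hi]
    · rw [tDM_mul_tDM_of_ne _ _ _ _ _ _ hb, map_zero]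
      rfl

theorem phi_mem_EndParity (s : ℂ) (p : ZMod 2) (x : SD) (hx : x ∈ SDParity p) :
    phi s x ∈ EndParity p := by
  refine SDParity_induction (p := fun x => phi s x ∈ EndParity p) p (by simp)
    (fun x y h h' => by rw [map_add]; exact add_mem h h') (fun a b k f h => ?_) x hx
  rintro ⟨i, m⟩ ⟨c, j⟩ hij
  change phi s (tDM k f a b) (e c j) (i, m) = 0
  rw [phi_tDM_single]
  split_ifs with hc
  · subst hc
    have : (i, m) ≠ (a, j - k) := by
      rintro ⟨⟩
      exact hij h
    simp [e, Finsupp.single_eq_of_ne this]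
  · rfl

theorem phi_mem_gl (s : ℂ) (x : SD) : phi s x ∈ gl := by
  refine SD_induction (p := fun x => phi s x ∈ gl) (by simp)
    (fun x y h h' => by rw [map_add]; exact add_mem h h') x (fun a b k _ => ?_)
  refine ⟨|k|, ?_⟩
  rintro ⟨i, m⟩ ⟨c, j⟩ hij
  change phi s (tDM k _ a b) (e c j) (i, m) = 0
  rw [phi_tDM_single]
  split_ifs with hc
  · have : (i, m) ≠ (a, j - k) := by
      rintro ⟨⟩
      simp at hij
    simp [e, Finsupp.single_eq_of_ne this]
  · rfl

/-- The `k`-th diagonal of the block `(a, b)` sees only the coefficient of `t^k M_{ab}`, sampled on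
`s + ℤ`. Both the kernel and the image of `phi s` are read off from this. -/
theorem phi_apply_coeff (s : ℂ) (x : SD) (a b : ZMod 2) (k j : ℤ) :
    phi s x (e b j) (a, j - k) = (coeff a b k x).1 (-j + s) := by
  refine SD_induction
    (p := fun x => phi s x (e b j) (a, j - k) = (coeff a b k x).1 (-j + s)) (by rw [map_zero, map_zero]; rfl)
    (fun x y h h' => by rw [map_add, map_add, LinearMap.add_apply, Finsupp.add_apply, h, h']; rfl) x
    fun a' b' l _ => ?_
  generalize coeff a' b' l x = f
  rw [phi_tDM_single, coeff_tDM]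
  by_cases hb : b = b'
  · subst hb
    by_cases h : a' = a ∧ l = k
    · obtain ⟨rfl, rfl⟩ := h
      simp [e]
    · have h1 : (a, j - k) ≠ (a', j - l) := by
        intro h'
        rw [Prod.mk.injEq] at h'
        exact h ⟨h'.1.symm, by linarith [h'.2]⟩
      rw [if_pos rfl, if_neg (by tauto)]
      simp [e, Finsupp.single_eq_of_ne h1]
  · rw [if_neg hb, if_neg (fun h => hb h.2.1.symm)]
    rfl

theorem coeff_mem_I_of_phi_eq_zero {s : ℂ} {x : SD} (hx : phi s x = 0) (a b : ZMod 2) (k : ℤ) :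
    coeff a b k x ∈ I s := by
  intro n
  have h := phi_apply_coeff s x a b k (-n)
  rw [hx] at h
  simpa using h.symm

theorem phi_tDM_eq_zero {s : ℂ} {f : entire} (hf : f ∈ I s) (k : ℤ) (a b : ZMod 2) :
    phi s (tDM k f a b) = 0 := by
  refine end_ext_e fun c j => ?_
  have h : f.1 (-j + s) = 0 := by
    simpa using hf (-j)
  rw [phi_tDM_single, h, zero_smul, ite_self]
  rfl

/-! ### Twisted reflections

The anti-involutions of `SD^𝒪` in question all have the form
`t^k f(D) M_{ab} ↦ η_{ab} γ^k t^{k+κ_a-κ_b} f(-D-k-κ_a-r) M_{π(b)π(a)}`. -/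

/-- The anti-involution
`t^k f(D) M_{ab} ↦ η_{ab} γ^k t^{k+κ_a-κ_b} f(-D-k-κ_a-r) M_{π(b)π(a)}`. -/
structure IsReflection (σ : SD →ₗ[ℂ] SD) (γ : ℂ) (η : ZMod 2 → ZMod 2 → ℂ) (π : ZMod 2 → ZMod 2)
    (κ : ZMod 2 → ℤ) (r : ℤ) : Prop where
  γ_sq : γ * γ = 1
  -- `η_mul` is the sign rule for reversing a product. `π_add` makes `σ` even, and `η_inv`, `π_π`,
  -- `κ_π` together with `γ_sq` make it an involution.
  η_mul : ∀ a b c, η a c = superSign (a + b) (b + c) * (η a b * η b c)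
  η_inv : ∀ a b, η a b * η (π b) (π a) * γ ^ (κ a - κ b) = 1
  π_add : ∀ a b, π b + π a = a + b
  π_π : ∀ a, π (π a) = a
  κ_π : ∀ a, κ (π a) = κ a
  map_tDM : ∀ k f a b, σ (tDM k f a b) = (η a b * γ ^ k) •
    tDM (k + κ a - κ b) (affComp (-1) (-(k + κ a + r)) f) (π b) (π a)

theorem inv_two_smul_sub_of_eq_neg {E : Type*} [AddCommGroup E] [Module ℂ E] {x y : E}
    (h : y = -x) : (2⁻¹ : ℂ) • (x - y) = x := by
  rw [h, sub_neg_eq_add, ← two_smul ℂ, smul_smul, inv_mul_cancel₀ two_ne_zero, one_smul]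

theorem map_eq_zero_of_eq_neg {E F : Type*} [AddCommGroup E] [Module ℂ E] [AddCommGroup F]
    [Module ℂ F] {φ : E →ₗ[ℂ] F} {x y : E} (h : y = -x) (hy : φ y = 0) : φ x = 0 := by
  rw [← neg_neg x, ← h, map_neg, hy, neg_zero]

theorem map_eq_neg_of_decompose {A F : Type} [Ring A] [Algebra ℂ A] {𝒜 : ZMod 2 → Submodule ℂ A}
    [GradedAlgebra 𝒜] [AddCommGroup F] [Module ℂ F] {φ : A →ₗ[ℂ] F} {σ : A →ₗ[ℂ] A}
    {x : A} (h : ∀ p, φ (σ (decompose 𝒜 x p)) = -φ (decompose 𝒜 x p)) : φ (σ x) = -φ x := by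
  classical
  rw [← sum_support_decompose 𝒜 x]
  simp only [map_sum, h, Finset.sum_neg_distrib]

theorem affComp_apply (a b : ℂ) (f : entire) (w : ℂ) : (affComp a b f).1 w = f.1 (a * w + b) := rfl

theorem entire_ext {f g : entire} (h : ∀ w, f.1 w = g.1 w) : f = g := Subtype.ext (funext h)

theorem affComp_neg_one_mem_I {s : ℂ} {f : entire} (hf : f ∈ I s) (k : ℤ) :
    affComp (-1) (-k) f ∈ I (-s) := fun n => by
  have h := hf (-n - k)
  rw [affComp_apply, ← h]
  refine congrArg f.1 ?_
  push_cast
  ring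

namespace IsReflection

variable {σ : SD →ₗ[ℂ] SD} {γ : ℂ} {η : ZMod 2 → ZMod 2 → ℂ} {π : ZMod 2 → ZMod 2} {κ : ZMod 2 → ℤ}
  {r : ℤ}

theorem γ_ne_zero (h : IsReflection σ γ η π κ r) : γ ≠ 0 :=
  left_ne_zero_of_mul_eq_one h.γ_sq

theorem mem_SDParity (h : IsReflection σ γ η π κ r) (p : ZMod 2) (x : SD) (hx : x ∈ SDParity p) :
    σ x ∈ SDParity p := by
  refine SDParity_induction (p := fun x => σ x ∈ SDParity p) p (by simp)
    (fun x y hx hy => by rw [map_add]; exact add_mem hx hy) (fun a b k f hab => ?_) x hx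
  rw [h.map_tDM, ← hab, ← h.π_add]
  exact Submodule.smul_mem _ _ (tDM_mem_SDParity _ _ _ _)

theorem map_mul (h : IsReflection σ γ η π κ r) (p q : ZMod 2) (x : SD) (hx : x ∈ SDParity p)
    (y : SD) (hy : y ∈ SDParity q) : σ (x * y) = superSign p q • (σ y * σ x) := by
  refine SDParity_induction (p := fun x => σ (x * y) = superSign p q • (σ y * σ x)) p (by simp)
    (fun x x' hx hx' => by simp only [add_mul, mul_add, map_add, smul_add, hx, hx'])
    (fun a b k f hab => ?_) x hx
  refine SDParity_induction
    (p := fun y => σ (tDM k f a b * y) = superSign p q • (σ y * σ (tDM k f a b))) q (by simp)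
    (fun x x' hx hx' => by simp only [add_mul, mul_add, map_add, smul_add, hx, hx'])
    (fun b' c l g hbc => ?_) y hy
  simp only [h.map_tDM]
  by_cases hb : b = b'
  · subst hb
    simp only [tDM_mul_tDM, h.map_tDM, smul_mul_smul_comm, smul_smul, h.η_mul a b c, ← hab, ← hbc,
      zpow_add₀ h.γ_ne_zero]
    congr 1
    · ring
    · congr 1
      · ring
      · rw [_root_.map_mul, mul_comm]
        congr 1 <;> refine entire_ext fun w => ?_
        · simp only [affComp_apply]
          refine congrArg (Subtype.val _) ?_
          push_cast
          ring
        · simp only [affComp_apply]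
          refine congrArg (Subtype.val _) ?_
          push_cast
          ring
  · rw [tDM_mul_tDM_of_ne _ _ _ _ _ _ hb, map_zero, smul_mul_smul_comm, tDM_mul_tDM_of_ne, smul_zero,
      smul_zero]
    -- `π` is an involution, hence injective, so inner indices that do not match still do not match
    -- after `σ`.
    intro hπ
    apply hb
    rw [← h.π_π b, ← hπ, h.π_π]

theorem isLieSubsuperalgebra (h : IsReflection σ γ η π κ r) :
    IsLieSubsuperalgebra SDParity (fixedBy σ) :=
  isLieSubsuperalgebra_ker_add_id h.mem_SDParity h.map_mul

theorem map_map (h : IsReflection σ γ η π κ r) (x : SD) : σ (σ x) = x := by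
  refine SD_induction (p := fun x => σ (σ x) = x) (by simp)
    (fun x y hx hy => by rw [map_add, map_add, hx, hy]) x fun a b k _ => ?_
  generalize coeff a b k x = f
  have hc : η a b * γ ^ k * (η (π b) (π a) * γ ^ (k + κ a - κ b)) = 1 := by
    have h1 : γ ^ k * γ ^ k = 1 := by rw [← mul_zpow, h.γ_sq, one_zpow]
    rw [add_sub_assoc, zpow_add₀ h.γ_ne_zero]
    linear_combination h.η_inv a b + η a b * η (π b) (π a) * γ ^ (κ a - κ b) * h1
  rw [h.map_tDM, map_smul, h.map_tDM, smul_smul, hc, one_smul, h.π_π, h.π_π, h.κ_π, h.κ_π]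
  congr 1
  · ring
  · refine entire_ext fun w => ?_
    simp only [affComp_apply]
    refine congrArg f.1 ?_
    push_cast
    ring

theorem mem_fixedBy {x : SD} : x ∈ fixedBy σ ↔ σ x = -x := by
  rw [fixedBy, LinearMap.mem_ker, LinearMap.add_apply, LinearMap.id_apply, add_eq_zero_iff_eq_neg]

theorem sub_mem_fixedBy (h : IsReflection σ γ η π κ r) (x : SD) : x - σ x ∈ fixedBy σ := by
  rw [mem_fixedBy, map_sub, h.map_map, neg_sub]

/-- The substitution `w ↦ -w - integer` carries `-s + ℤ` to `s + ℤ`, so it turns coefficients in `I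
s` into coefficients in `I (-s)`. -/
theorem phi_map_eq_zero (h : IsReflection σ γ η π κ r) {s : ℂ} {x : SD} (hx : phi s x = 0) :
    phi (-s) (σ x) = 0 := by
  refine SD_induction (p := fun x => phi (-s) (σ x) = 0) (by simp)
    (fun x y hx hy => by rw [map_add, map_add, hx, hy, add_zero]) x fun a b k _ => ?_
  have hf := affComp_neg_one_mem_I (coeff_mem_I_of_phi_eq_zero hx a b k) (k + κ a + r)
  rw [h.map_tDM, map_smul, phi_tDM_eq_zero (by simpa using hf), smul_zero]

/-- From `σ x = -x`, an element killed by `φ_s` is killed by `φ_{-s}` too, so all its coefficients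
lie in `I s ∩ I (-s)`. As `x = (x - σ x)/2`, it suffices to place the antisymmetrised monomials in
`J`. -/
theorem fixedBy_inf_ker_le (h : IsReflection σ γ η π κ r) {s : ℂ} {J : Submodule ℂ SD}
    (hJ : ∀ a b k, ∀ f ∈ I s ∩ I (-s), tDM k f a b - σ (tDM k f a b) ∈ J) :
    fixedBy σ ⊓ LinearMap.ker (phi s) ≤ J := by
  rintro x ⟨hx, hx0⟩
  have hx : σ x = -x := mem_fixedBy.1 hx
  have hx0 : phi s x = 0 := hx0
  have hx1 : phi (-s) x = 0 := by
    exact map_eq_zero_of_eq_neg (E := SD) (F := Module.End ℂ V) hx (h.phi_map_eq_zero hx0)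
  have hmem : x - σ x ∈ J :=
    SD_induction (p := fun x => x - σ x ∈ J) (by simp)
      (fun x y hx hy => by rw [map_add, add_sub_add_comm]; exact add_mem hx hy) x fun a b k _ =>
        hJ a b k _ ⟨coeff_mem_I_of_phi_eq_zero hx0 a b k, coeff_mem_I_of_phi_eq_zero hx1 a b k⟩
  have hx2 : x = (2⁻¹ : ℂ) • (x - σ x) := (inv_two_smul_sub_of_eq_neg hx).symm
  rw [hx2]
  exact J.smul_mem _ hmem

end IsReflection

/-! ### The image of `φ_s` -/

/-- Each diagonal of each block prescribes the values of one coefficient on `s + ℤ`, and a band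
matrix has finitely many nonzero diagonals. The set `S` records extra conditions on the
interpolants; taking `S = I s'` yields a lift that `φ_{s'}` kills. -/
theorem exists_phi_eq {s : ℂ} {S : Set entire}
    (hS : ∀ a : ℤ → ℂ, ∃ f ∈ S, ∀ n : ℤ, f.1 (n + s) = a n) {T : Module.End ℂ V} (hT : T ∈ gl) :
    ∃ x, phi s x = T ∧ ∀ s', S ⊆ I s' → phi s' x = 0 := by
  obtain ⟨N, hN⟩ := hT
  -- The node `n + s` belongs to the column `j = -n`, because `f` acts on `e_j` through `f(-j + s)`.
  choose f hfS hf using fun (a b : ZMod 2) (k : ℤ) => hS fun n => T (e b (-n)) (a, -n - k)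
  refine ⟨∑ a, ∑ b, ∑ k ∈ Finset.Icc (-N) N, tDM k (f a b k) a b, end_ext ?_, fun s' hs' => ?_⟩
  · rintro ⟨a, m⟩ ⟨b, j⟩
    have h := phi_apply_coeff s (∑ a, ∑ b, ∑ k ∈ Finset.Icc (-N) N, tDM k (f a b k) a b) a b (j - m) j
    rw [sub_sub_cancel] at h
    refine h.trans ?_
    simp only [map_sum, coeff_tDM]
    rw [Finset.sum_eq_single a (fun a' _ ha => by simp [ha]) (by simp),
      Finset.sum_eq_single b (fun b' _ hb => by simp [hb]) (by simp)]
    simp only [true_and, Finset.sum_ite_eq', Finset.mem_Icc, ← abs_le]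
    split_ifs with hjm
    · have h := hf a b (j - m) (-j)
      simpa [e] using h
    · refine (hN (a, m) (b, j) ?_).symm
      rw [abs_sub_comm]
      exact not_le.1 hjm
  · simp only [map_sum]
    exact Finset.sum_eq_zero fun a _ => Finset.sum_eq_zero fun b _ => Finset.sum_eq_zero fun k _ =>
      phi_tDM_eq_zero (hs' (hfS a b k)) k a b

/-- If `x` lifts `T` with coefficients in `I (-s)`, then `φ_s (σ x) = 0`, so antisymmetrising `x`
does not change its image. -/
theorem IsReflection.map_phi_fixedBy_eq_gl {σ : SD →ₗ[ℂ] SD} {γ : ℂ} {η : ZMod 2 → ZMod 2 → ℂ}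
    {π : ZMod 2 → ZMod 2} {κ : ZMod 2 → ℤ} {r : ℤ} (h : IsReflection σ γ η π κ r) {s : ℂ}
    (hs : ∀ n : ℤ, s ≠ n / 2) : (fixedBy σ).map (phi s) = gl := by
  refine le_antisymm ?_ fun T hT => ?_
  · rintro _ ⟨x, _, rfl⟩
    exact phi_mem_gl s x
  · obtain ⟨x, hx, hx'⟩ := exists_phi_eq (exists_entire_interpolation_vanishing hs) hT
    refine ⟨x - σ x, h.sub_mem_fixedBy x, ?_⟩
    have h0 := h.phi_map_eq_zero (hx' (-s) subset_rfl)
    rw [neg_neg] at h0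
    rw [map_sub, hx, h0]
    exact sub_zero T

/-! ### Operators preserving a form -/

theorem mem_preserving {β : V →ₗ[ℂ] V →ₗ[ℂ] ℂ} {T : Module.End ℂ V} :
    T ∈ preserving β ↔ T ∈ gl ∧ ∀ p q : ZMod 2, ∀ v ∈ VParity q, ∀ w : V,
    β ((decompose EndParity T p : Module.End ℂ V) v) w =
      -(superSign p q * β v ((decompose EndParity T p : Module.End ℂ V) w)) := Iff.rfl

theorem e_mem_VParity (c : ZMod 2) (j : ℤ) : e c j ∈ VParity c := fun _ hi =>
  Finsupp.single_eq_of_ne fun h => hi (congrArg Prod.fst h)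

/-- Adjointness on basis vectors extends by bilinearity. The sign depends on the parity of `v` only,
so `v` has to be homogeneous while `w` is arbitrary. -/
theorem form_adjoint {β : V →ₗ[ℂ] V →ₗ[ℂ] ℂ} {σ : SD →ₗ[ℂ] SD}
    (hadj : ∀ k f a b c j c' m, β (phi 0 (tDM k f a b) (e c j)) (e c' m) =
      superSign (a + b) c * β (e c j) (phi 0 (σ (tDM k f a b)) (e c' m)))
    (p q : ZMod 2) (x : SD) (hx : x ∈ SDParity p) (v : V) (hv : v ∈ VParity q) (w : V) :
    β (phi 0 x v) w = superSign p q * β v (phi 0 (σ x) w) := by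
  refine SDParity_induction (p := fun x => β (phi 0 x v) w = superSign p q * β v (phi 0 (σ x) w)) p
    (by simp) (fun x y hx hy => by
      simp only [map_add, LinearMap.add_apply, hx, hy, mul_add]) (fun a b k f hab => ?_) x hx
  rw [← Finsupp.sum_single v]
  refine Finset.sum_induction _
    (fun v => β (phi 0 (tDM k f a b) v) w = superSign p q * β v (phi 0 (σ (tDM k f a b)) w))
    (fun v v' h h' => by simp only [map_add, LinearMap.add_apply, h, h', mul_add]) (by simp)
    fun i hi => ?_
  have hi : i.1 = q := by
    by_contra h
    exact Finsupp.mem_support_iff.1 hi (hv i h)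
  refine Finsupp.induction_linear w (by simp) (fun w w' h h' => by
    simp only [map_add, h, h', mul_add]) fun l u => ?_
  have h := hadj k f a b i.1 i.2 l.1 l.2
  have h1 : ∀ (i : Idx) (u : ℂ), Finsupp.single i u = u • e i.1 i.2 := fun i u => by
    simp [e]
  rw [hab, hi] at h
  simp only [h1, map_smul, LinearMap.smul_apply, hi, h, smul_eq_mul]
  ring

/-- With `σ` as super-adjoint, preserving the form means `φ_0 (σ x) = -φ_0 x` on each homogeneous
part; nondegeneracy yields this equality from the pairings. Then `(x - σ x)/2` is a fixed element
with the same image as `x`. -/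
theorem IsReflection.map_phi_fixedBy_eq_preserving {σ : SD →ₗ[ℂ] SD} {γ : ℂ}
    {η : ZMod 2 → ZMod 2 → ℂ} {π : ZMod 2 → ZMod 2} {κ : ZMod 2 → ℤ} {r : ℤ}
    (h : IsReflection σ γ η π κ r) {β : V →ₗ[ℂ] V →ₗ[ℂ] ℂ}
    (hadj : ∀ k f a b c j c' m, β (phi 0 (tDM k f a b) (e c j)) (e c' m) =
      superSign (a + b) c * β (e c j) (phi 0 (σ (tDM k f a b)) (e c' m)))
    (hβ : ∀ w, (∀ c j, β (e c j) w = 0) → w = 0) : (fixedBy σ).map (phi 0) = preserving β := by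
  have hdec := decompose_map_apply (A := SD) (B := Module.End ℂ V) (𝒜 := SDParity)
    (ℬ := EndParity) (φ := phi 0) (phi_mem_EndParity 0)
  refine le_antisymm ?_ fun T hT => ?_
  · rintro _ ⟨x, hx, rfl⟩
    refine mem_preserving.2 ⟨phi_mem_gl 0 x, fun p q v hv w => ?_⟩
    rw [hdec, form_adjoint hadj p q _ (decompose SDParity x p).2 v hv w,
      mem_fixedBy.1 (h.isLieSubsuperalgebra.graded x hx p), map_neg, LinearMap.neg_apply, map_neg,
      mul_neg]
  · rw [mem_preserving] at hT
    obtain ⟨x, rfl, -⟩ := exists_phi_eq (S := Set.univ)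
      (fun a => (exists_entire_interpolation_int 0 a).imp fun f hf => ⟨Set.mem_univ f, hf⟩) hT.1
    have hσ : ∀ p, phi 0 (σ (decompose SDParity x p)) = -phi 0 (decompose SDParity x p) := by
      intro p
      refine LinearMap.ext fun w => ?_
      rw [LinearMap.neg_apply, ← add_eq_zero_iff_eq_neg]
      refine hβ _ fun c j => ?_
      have h1 := form_adjoint hadj p c _ (decompose SDParity x p).2 _ (e_mem_VParity c j) w
      have h2 := hT.2 p c _ (e_mem_VParity c j) w
      rw [hdec, h1] at h2
      have h3 := superSign_mul_self p c
      rw [map_add]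
      linear_combination superSign p c * h2 - (β (e c j) (phi 0 (σ (decompose SDParity x p)) w) +
        β (e c j) (phi 0 (decompose SDParity x p) w)) * h3
    have hσx : phi 0 (σ x) = -phi 0 x :=
      map_eq_neg_of_decompose (A := SD) (F := Module.End ℂ V) (𝒜 := SDParity) (φ := phi 0)
        hσ
    refine ⟨(2⁻¹ : ℂ) • (x - σ x), Submodule.smul_mem _ _ (h.sub_mem_fixedBy x), ?_⟩
    rw [map_smul, map_sub]
    exact inv_two_smul_sub_of_eq_neg hσx

theorem formOf_e_e (G : Idx → Idx → ℂ) (a b : ZMod 2) (i j : ℤ) :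
    formOf G (e a i) (e b j) = G (a, i) (b, j) := by
  simp [formOf, e]

/-- If some row of the Gram matrix has its only nonzero entry in column `l`, pairing with that basis
vector isolates the `l`-th coordinate of `w`. -/
theorem formOf_nondegenerate {G : Idx → Idx → ℂ}
    (hG : ∀ l, ∃ i, G i l ≠ 0 ∧ ∀ l', l' ≠ l → G i l' = 0) (w : V)
    (hw : ∀ c j, formOf G (e c j) w = 0) : w = 0 := by
  ext l
  obtain ⟨i, hi, hi'⟩ := hG l
  have h := hw i.1 i.2
  simp only [formOf, e, Finsupp.linearCombination_single, one_smul] at h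
  rw [Finsupp.linearCombination_apply, Finsupp.sum, Finset.sum_eq_single l
    (fun l' _ hl => by rw [hi' l' hl, smul_zero])
    (fun hl => by rw [Finsupp.notMem_support_iff.1 hl, zero_smul]), smul_eq_mul] at h
  exact (mul_eq_zero.1 h).resolve_right hi

/-! ### The anti-involutions `⁰σ` and `^{cd}σ` -/

theorem eq_zero_or_eq_one (a : ZMod 2) : a = 0 ∨ a = 1 := by
  revert a
  decide

theorem one_add_one : (1 + 1 : ZMod 2) = 0 := rfl

theorem val_one : (1 : ZMod 2).val = 1 := rfl

theorem units_cast_zpow (c : ℤˣ) (k : ℤ) : (((c ^ k : ℤˣ) : ℤ) : ℂ) = ((c : ℤ) : ℂ) ^ k := by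
  have h := congrArg Units.val (map_zpow (Units.map (Int.castRingHom ℂ).toMonoidHom) c k)
  rw [Units.val_zpow_eq_zpow_val] at h
  rw [Units.coe_map, Units.coe_map] at h
  exact h

theorem units_cast_mul_self (c : ℤˣ) : ((c : ℤ) : ℂ) * ((c : ℤ) : ℂ) = 1 := by
  rw [← Int.cast_mul, ← Units.val_mul, Int.units_mul_self]
  simp

theorem neg_one_zpow_mul_self (k : ℤ) : (-1 : ℂ) ^ k * (-1) ^ k = 1 := by
  rw [← mul_zpow]
  simp

theorem zpow_sub_of_mul_self {γ : ℂ} (h : γ * γ = 1) (j k : ℤ) : γ ^ (j - k) = γ ^ k * γ ^ j := by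
  have hγ : γ ≠ 0 := left_ne_zero_of_mul_eq_one h
  have hk : γ ^ k * γ ^ k = 1 := by rw [← mul_zpow, h, one_zpow]
  rw [zpow_sub₀ hγ, div_eq_iff (zpow_ne_zero k hγ)]
  linear_combination (-γ ^ j) * hk

theorem M_eq_tDM (a b : ZMod 2) : M a b = tDM 0 1 a b := rfl

theorem reflect_apply (x y : ℂ) (f : entire) :
    reflect x y f = tDM 0 (affComp (-1) x f) 0 0 + tDM 0 (affComp (-1) y f) 1 1 := rfl

theorem signedT_eq (c : ℤˣ) (k : ℤ) :
    signedT c k = ((c : ℤ) : ℂ) ^ k • (tDM k 1 0 0 + tDM k 1 1 1) := by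
  rw [signedT, ← units_cast_zpow, Int.cast_smul_eq_zsmul]
  congr 1
  ext i j : 2
  obtain rfl | rfl := eq_zero_or_eq_one i <;> obtain rfl | rfl := eq_zero_or_eq_one j <;> simp [tDM]

/-- The column index `b` selects one of the two reflections, and moving `t^k` to the left shifts the
argument of the reflected function by `-k`. -/
theorem tDM_one_mul_reflect_mul_signedT (l k : ℤ) (x y : ℂ) (f : entire) (c : ℤˣ) (a b : ZMod 2) :
    tDM l 1 a b * reflect x y f * signedT c k = ((c : ℤ) : ℂ) ^ k •
      tDM (l + k) (affComp (-1) ((if b = 0 then x else y) - k) f) a b := by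
  have h : ∀ x, affComp 1 k (affComp (-1) x f) = affComp (-1) (x - k) f := fun x =>
    entire_ext fun w => congrArg f.1 (by ring)
  rw [reflect_apply, signedT_eq, mul_smul_comm]
  congr 1
  obtain rfl | rfl := eq_zero_or_eq_one b
  · simp [mul_add, tDM_mul_tDM, tDM_mul_tDM_of_ne, h]
  · simp [mul_add, tDM_mul_tDM, tDM_mul_tDM_of_ne, h]

/-- The signs of `⁰σ`. -/
def etaZero (a b : ZMod 2) : ℂ := if a = 0 ∧ b = 1 then -1 else 1

/-- The signs of `^{cd}σ`. -/
def etaSign (d : ℤˣ) (a b : ZMod 2) : ℂ :=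
  if a = b then 1 else if a = 0 then -((d : ℤ) : ℂ) else ((d : ℤ) : ℂ)

/-- Matrix units are transposed, so `π = id`. The exponent `κ` records the extra powers in `θ ↦ t
∂_θ` and `∂_θ ↦ -t⁻¹ θ`, and also the difference between `f(-D)` on `M_0` and `f(-D - 1)` on `M_1`.
-/
theorem isReflection_sigmaZero :
    IsReflection sigmaZero (-1) etaZero id (fun a => (a.val : ℤ)) 0 where
  γ_sq := by norm_num
  η_mul a b c := by
    obtain rfl | rfl := eq_zero_or_eq_one a <;>
    obtain rfl | rfl := eq_zero_or_eq_one b <;>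
    obtain rfl | rfl := eq_zero_or_eq_one c <;>
    simp [etaZero, superSign, one_add_one, val_one]
  η_inv a b := by
    obtain rfl | rfl := eq_zero_or_eq_one a <;>
    obtain rfl | rfl := eq_zero_or_eq_one b <;>
    simp [etaZero, val_one]
  π_add a b := add_comm _ _
  π_π _ := rfl
  κ_π _ := rfl
  map_tDM k f a b := by
    rw [sigmaZero, antiMap_tDM]
    obtain rfl | rfl := eq_zero_or_eq_one a <;> obtain rfl | rfl := eq_zero_or_eq_one b <;>
      simp [block, M_eq_tDM, tDM_one_mul_reflect_mul_signedT, etaZero, val_one]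
    all_goals ring_nf

/-- Exchanging `M_0` and `M_1` while keeping the slots of `M_+` and `M_-` is transposition followed
by swapping both indices, whence `π a = a + 1`; `r = 1` comes from `D ↦ -D - 1`. -/
theorem isReflection_sigmaSign (c d : ℤˣ) :
    IsReflection (sigmaSign c d) ((c : ℤ) : ℂ) (etaSign d) (· + 1) (fun _ => 0) 1 where
  γ_sq := units_cast_mul_self c
  η_mul a b c := by
    have h := units_cast_mul_self d
    obtain rfl | rfl := eq_zero_or_eq_one a <;>
    obtain rfl | rfl := eq_zero_or_eq_one b <;>
    obtain rfl | rfl := eq_zero_or_eq_one c <;>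
    simp [etaSign, superSign, one_add_one, val_one, h]
  η_inv a b := by
    have h := units_cast_mul_self d
    obtain rfl | rfl := eq_zero_or_eq_one a <;>
    obtain rfl | rfl := eq_zero_or_eq_one b <;>
    simp [etaSign, one_add_one, h]
  π_add a b := by revert a b; decide
  π_π a := by revert a; decide
  κ_π _ := rfl
  map_tDM k f a b := by
    rw [sigmaSign, antiMap_tDM]
    obtain rfl | rfl := eq_zero_or_eq_one a <;> obtain rfl | rfl := eq_zero_or_eq_one b <;>
      simp [-zsmul_eq_mul, block, M_eq_tDM, tDM_one_mul_reflect_mul_signedT, etaSign, one_add_one,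
        sub_eq_add_neg]
    all_goals rw [← Int.cast_smul_eq_zsmul ℂ, smul_smul]

theorem sigmaZero_adjoint (k : ℤ) (f : entire) (a b c : ZMod 2) (j : ℤ) (c' : ZMod 2) (m : ℤ) :
    formOSP (phi 0 (tDM k f a b) (e c j)) (e c' m) =
      superSign (a + b) c * formOSP (e c j) (phi 0 (sigmaZero (tDM k f a b)) (e c' m)) := by
  rw [isReflection_sigmaZero.map_tDM]
  obtain rfl | rfl := eq_zero_or_eq_one a <;>
  obtain rfl | rfl := eq_zero_or_eq_one b <;>
  obtain rfl | rfl := eq_zero_or_eq_one c <;>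
  obtain rfl | rfl := eq_zero_or_eq_one c' <;>
    simp [phi_tDM_single, formOSP, formOf_e_e, superSign, etaZero, affComp_apply, val_one, one_add_one]
  all_goals
    split_ifs with h1 h2 h2
    -- The form pairs indices with sum `0` in even parity and `1` in odd parity. For the admissible
    -- `m`, the reflected function is evaluated at `-j` again, so only signs remain to be compared.
    · have hm : m = k - j ∨ m = 1 + k - j := by omega
      obtain rfl | rfl := hm
      all_goals first
      | exfalso
        omega
      | push_cast
        rw [zpow_sub_of_mul_self (by norm_num)]
        ring_nf
    · omega
    · omega
    · simp

theorem sigmaSign_adjoint (γ d : ℤˣ) (k : ℤ) (f : entire) (a b c : ZMod 2) (j : ℤ) (c' : ZMod 2)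
    (m : ℤ) :
    formOdd γ (γ * d) (phi 0 (tDM k f a b) (e c j)) (e c' m) =
      superSign (a + b) c *
        formOdd γ (γ * d) (e c j) (phi 0 (sigmaSign γ d (tDM k f a b)) (e c' m)) := by
  rw [(isReflection_sigmaSign γ d).map_tDM]
  obtain rfl | rfl := eq_zero_or_eq_one a <;>
  obtain rfl | rfl := eq_zero_or_eq_one b <;>
  obtain rfl | rfl := eq_zero_or_eq_one c <;>
  obtain rfl | rfl := eq_zero_or_eq_one c' <;>
    simp [phi_tDM_single, formOdd, formOf_e_e, superSign, etaSign, affComp_apply, val_one, one_add_one]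
  all_goals
    split_ifs with h1 h2 h2
    -- The odd form always pairs indices with sum `1`, so a single `m` contributes; at it the
    -- reflected argument equals `-j`.
    · obtain rfl : m = 1 + k - j := by omega
      have hf : ((1 + k - j : ℤ) : ℂ) + (-1 + -k) = -j := by
        push_cast
        ring
      have hγ := units_cast_mul_self γ
      have hd := units_cast_mul_self d
      have hm : (1 + k - j) - k = 1 - j := by ring
      simp only [hf, hm, units_cast_zpow, zpow_sub_of_mul_self hγ,
        zpow_add₀ (left_ne_zero_of_mul_eq_one hγ), zpow_one]
      first
      | ring1
      | linear_combination (-f.1 (-j) * ((γ : ℤ) : ℂ) ^ k * ((γ : ℤ) : ℂ) ^ j) *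
          (((d : ℤ) : ℂ) * ((d : ℤ) : ℂ) * hγ + hd)
      | linear_combination (f.1 (-j) * ((γ : ℤ) : ℂ) ^ k * ((γ : ℤ) : ℂ) ^ j * ((d : ℤ) : ℂ)) * hγ
    · omega
    · omega
    · simp

/-! ### Nondegeneracy of the forms -/

theorem formOSP_nondegenerate (w : V) (hw : ∀ c j, formOSP (e c j) w = 0) : w = 0 := by
  refine formOf_nondegenerate ?_ w hw
  rintro ⟨b, m⟩
  obtain rfl | rfl := eq_zero_or_eq_one b
  · refine ⟨(0, -m), by simp [zpow_ne_zero], ?_⟩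
    rintro ⟨b', m'⟩ h
    have : ¬ (b' = 0 ∧ -m + m' = 0) := by
      rintro ⟨rfl, h'⟩
      exact h (by rw [show m' = m by omega])
    simp only [true_and, if_neg this]
    simp
  · refine ⟨(1, 1 - m), by simp [zpow_ne_zero], ?_⟩
    rintro ⟨b', m'⟩ h
    have : ¬ (b' = 1 ∧ 1 - m + m' = 1) := by
      rintro ⟨rfl, h'⟩
      exact h (by rw [show m' = m by omega])
    simp only [true_and, if_neg this]
    simp

theorem formOdd_nondegenerate (c ε : ℤˣ) (w : V) (hw : ∀ b j, formOdd c ε (e b j) w = 0) :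
    w = 0 := by
  refine formOf_nondegenerate ?_ w hw
  rintro ⟨b, m⟩
  obtain rfl | rfl := eq_zero_or_eq_one b
  · refine ⟨(1, 1 - m), by simp, ?_⟩
    rintro ⟨b', m'⟩ h
    have : ¬ (b' = 0 ∧ 1 - m + m' = 1) := by
      rintro ⟨rfl, h'⟩
      exact h (by rw [show m' = m by omega])
    simp only [true_and, if_neg this]
    simp
  · refine ⟨(0, 1 - m), by simp, ?_⟩
    rintro ⟨b', m'⟩ h
    have : ¬ (b' = 1 ∧ 1 - m + m' = 1) := by
      rintro ⟨rfl, h'⟩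
      exact h (by rw [show m' = m by omega])
    simp only [true_and, if_neg this]
    simp

/-! ### The kernels -/

theorem smul_mem_I {s : ℂ} {f : entire} (hf : f ∈ I s ∩ I (-s)) (c : ℂ) :
    c • f ∈ I s ∩ I (-s) :=
  ⟨fun n => (congrArg (c * ·) (hf.1 n)).trans (mul_zero c),
    fun n => (congrArg (c * ·) (hf.2 n)).trans (mul_zero c)⟩

theorem affComp_neg_one_mem_I_inter {s : ℂ} {f : entire} (hf : f ∈ I s ∩ I (-s)) (k : ℤ) :
    affComp (-1) (-k) f ∈ I s ∩ I (-s) := by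
  refine ⟨?_, affComp_neg_one_mem_I hf.1 k⟩
  have h := affComp_neg_one_mem_I hf.2 k
  rwa [neg_neg] at h

theorem affComp_half_mem_I {j : ℤ} {s : ℂ} {k : ℤ} {f : entire} (hf : f ∈ IParity j s k) :
    affComp 1 (k / 2) f ∈ I s := fun n => by
  rw [← hf.2 n]
  exact congrArg f.1 (by ring)

/-- Translating by `k/2` moves the centre `-k/2` of the reflection `w ↦ -w - k` to the origin, where
invariance up to sign becomes ordinary parity. -/
theorem affComp_neg_affComp_half {j : ℤ} {s : ℂ} {k : ℤ} {f : entire} (hf : f ∈ IParity j s k) :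
    affComp (-1) (-k) (affComp 1 (k / 2) f) = (-1 : ℂ) ^ j • affComp 1 (k / 2) f := by
  refine entire_ext fun w => ?_
  refine Eq.trans ?_ (hf.1 (1 * w + k / 2))
  exact congrArg f.1 (by ring)

/-- Symmetrising about `-k/2` and recentring produces a function of the prescribed parity.
Membership in both `I s` and `I (-s)` is needed so that the reflected summand also vanishes on `s +
ℤ`. -/
theorem exists_affComp_half_eq (j : ℤ) {s : ℂ} (k : ℤ) {f : entire} (hf : f ∈ I s ∩ I (-s)) :
    ∃ F ∈ IParity j s k, f + (-1 : ℂ) ^ j • affComp (-1) (-k) f = affComp 1 (k / 2) F := by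
  refine ⟨affComp 1 (-(k / 2)) (f + (-1 : ℂ) ^ j • affComp (-1) (-k) f), ⟨fun w => ?_, fun n => ?_⟩,
    entire_ext fun w => congrArg (f + (-1 : ℂ) ^ j • affComp (-1) (-k) f).1 (by ring)⟩
  · have h1 : -1 * (1 * -w + -((k : ℂ) / 2)) + -k = 1 * w + -(k / 2) := by ring
    have h2 : -1 * (1 * w + -((k : ℂ) / 2)) + -k = 1 * -w + -(k / 2) := by ring
    change f.1 (1 * -w + -(k / 2)) + (-1) ^ j * f.1 (-1 * (1 * -w + -(k / 2)) + -k) =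
      (-1) ^ j * (f.1 (1 * w + -(k / 2)) + (-1) ^ j * f.1 (-1 * (1 * w + -(k / 2)) + -k))
    rw [h1, h2]
    linear_combination (-f.1 (1 * -w + -(k / 2))) * neg_one_zpow_mul_self j
  · have h1 : 1 * ((n : ℂ) + k / 2 + s) + -(k / 2) = n + s := by ring
    have h2 := (affComp_neg_one_mem_I_inter hf k).1 n
    change f.1 _ + (-1) ^ j * (affComp (-1) (-k) f).1 _ = 0
    rw [h1, h2, hf.1 n, mul_zero, add_zero]

theorem neg_one_zpow_signExp (c : ℤˣ) : (-1 : ℂ) ^ signExp c = ((c : ℤ) : ℂ) := by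
  obtain rfl | rfl := Int.units_eq_one_or c
  · simp [signExp]
  · have h : (-1 : ℤˣ) ≠ 1 := by decide
    simp [signExp, h]

theorem IsReflection.sub_mem_fixedBy_inf_ker {σ : SD →ₗ[ℂ] SD} {γ : ℂ} {η : ZMod 2 → ZMod 2 → ℂ}
    {π : ZMod 2 → ZMod 2} {κ : ZMod 2 → ℤ} {r : ℤ} (h : IsReflection σ γ η π κ r) {s : ℂ}
    {f : entire} (hf : f ∈ I s ∩ I (-s)) (k : ℤ) (a b : ZMod 2) :
    tDM k f a b - σ (tDM k f a b) ∈ fixedBy σ ⊓ LinearMap.ker (phi s) := by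
  refine ⟨h.sub_mem_fixedBy _, ?_⟩
  have h1 := h.phi_map_eq_zero (phi_tDM_eq_zero hf.2 k a b)
  rw [neg_neg] at h1
  exact (LinearMap.ker (phi s)).sub_mem (phi_tDM_eq_zero hf.1 k a b) h1

/-- `⁰σ` preserves the slots of `M_0` and `M_1`, giving coefficients with a parity, and exchanges
`M_+` with `M_-`, giving the mixed generators. The parity `k + 1` is the sign `-(-1)^k` of `x - σ
x`. -/
theorem sigmaZero_ker (s : ℂ) : SDZero ⊓ LinearMap.ker (phi s) = JZero s := by
  have h := isReflection_sigmaZero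
  have hpow : ∀ k : ℤ, (-1 : ℂ) ^ (k + 1) = -(-1) ^ k := fun k => by
    rw [zpow_add_one₀ (by norm_num)]
    ring
  have hcast : ∀ (k : ℤ) (x : SD), (((-1) ^ k : ℤˣ) : ℤ) • x = (-1 : ℂ) ^ k • x := fun k x => by
    rw [← Int.cast_smul_eq_zsmul ℂ, units_cast_zpow]
    simp
  refine le_antisymm (h.fixedBy_inf_ker_le fun a b k f hf => ?_) (Submodule.span_le.2 ?_)
  · rw [h.map_tDM]
    obtain rfl | rfl := eq_zero_or_eq_one a <;> obtain rfl | rfl := eq_zero_or_eq_one b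
    · obtain ⟨F, hF, hF'⟩ := exists_affComp_half_eq (k + 1) k hf
      refine Submodule.subset_span (Set.mem_iUnion.2 ⟨k, Or.inl (Or.inl ⟨F, hF, ?_⟩)⟩)
      rw [← hF', tDM_add, tDM_smul, hpow]
      simp [etaZero, sub_eq_add_neg]
    -- Starting from `t^k f M_+`, the `M_-` component of the antisymmetrisation is `t^{k-1}` times
    -- `(-1)^k f(-D-k)`, so this is `g`; reflecting it again recovers `f`.
    · refine Submodule.subset_span (Set.mem_iUnion.2 ⟨k, Or.inr
        ⟨_, smul_mem_I (affComp_neg_one_mem_I_inter hf k) ((-1) ^ k), ?_⟩⟩)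
      have hff : affComp (-1) (-k) (affComp (-1) (-k) f) = f :=
        entire_ext fun w => congrArg f.1 (by ring)
      rw [hcast, map_smul, hff, tDM_smul, tDM_smul, smul_smul, neg_one_zpow_mul_self]
      simp [etaZero, val_one]
    · refine Submodule.subset_span (Set.mem_iUnion.2 ⟨k + 1, Or.inr ⟨f, hf, ?_⟩⟩)
      rw [hcast, hpow]
      simp [etaZero, val_one, sub_eq_neg_add]
    · obtain ⟨F, hF, hF'⟩ := exists_affComp_half_eq (k + 1) (k + 1) hf
      refine Submodule.subset_span (Set.mem_iUnion.2 ⟨k, Or.inl (Or.inr ⟨F, hF, ?_⟩)⟩)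
      have hk : (((k + 1 : ℤ) : ℂ)) = k + 1 := by push_cast; rfl
      rw [hk] at hF'
      rw [← hF', tDM_add, tDM_smul, hpow]
      simp [etaZero, sub_eq_add_neg, val_one]
  · refine Set.iUnion_subset fun k => ?_
    rintro x ((⟨f, hf, rfl⟩ | ⟨f, hf, rfl⟩) | ⟨g, hg, rfl⟩)
    · refine ⟨IsReflection.mem_fixedBy.2 ?_, phi_tDM_eq_zero (affComp_half_mem_I hf) _ _ _⟩
      have h1 := affComp_neg_affComp_half hf
      rw [h.map_tDM]
      simp only [etaZero, id]
      simp only [ZMod.val_zero, Nat.cast_zero, Int.cast_zero, add_zero, sub_zero, h1, tDM_smul,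
        smul_smul, hpow]
      have := neg_one_zpow_mul_self k
      simp [this]
    · have hk : (((k + 1 : ℤ) : ℂ)) = k + 1 := by push_cast; rfl
      have h0 := affComp_half_mem_I hf
      have h1 := affComp_neg_affComp_half hf
      rw [hk] at h0 h1
      refine ⟨IsReflection.mem_fixedBy.2 ?_, phi_tDM_eq_zero h0 _ _ _⟩
      rw [h.map_tDM]
      simp only [etaZero, id]
      simp only [val_one, Nat.cast_one, Int.cast_one, Int.cast_zero, add_zero, h1, tDM_smul,
        smul_smul, hpow]
      have := neg_one_zpow_mul_self k
      simp [this]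
    -- The mixed generator is `t^{k-1} g(D) M_-` minus its image under `⁰σ`.
    · have h1 := h.sub_mem_fixedBy_inf_ker hg (k - 1) 1 0
      rw [h.map_tDM] at h1
      have hp : (-1 : ℂ) ^ k = -(-1) ^ (k - 1) := by rw [← hpow, sub_add_cancel]
      rw [hcast, hp]
      change _ ∈ fixedBy sigmaZero ⊓ LinearMap.ker (phi s)
      convert h1 using 1
      simp [etaZero, val_one, sub_eq_neg_add]

/-- Compared with `⁰σ` the roles are reversed: `M_0` and `M_1` are exchanged and give two-term
generators, while `M_±` keep their slots and give functions whose parity is dictated by the signs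
`c`, `d`. -/
theorem sigmaSign_ker (c d : ℤˣ) (s : ℂ) : SDSign c d ⊓ LinearMap.ker (phi s) = JSign c d s := by
  have h := isReflection_sigmaSign c d
  have hc := units_cast_mul_self c
  have hc0 := left_ne_zero_of_mul_eq_one hc
  have hd := units_cast_mul_self d
  have hcc : ∀ k : ℤ, ((c : ℤ) : ℂ) ^ k * ((c : ℤ) : ℂ) ^ k = 1 := fun k => by
    rw [← mul_zpow, hc, one_zpow]
  have hcast : ∀ (k : ℤ) (x : SD), ((c ^ k : ℤˣ) : ℤ) • x = ((c : ℤ) : ℂ) ^ k • x := fun k x => by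
    rw [← Int.cast_smul_eq_zsmul ℂ, units_cast_zpow]
  have hplus : ∀ k : ℤ, (-1 : ℂ) ^ signExp (d * c ^ k) = (d : ℤ) * ((c : ℤ) : ℂ) ^ k := fun k => by
    rw [neg_one_zpow_signExp, Units.val_mul, Int.cast_mul, units_cast_zpow]
  have hminus : ∀ k : ℤ, (-1 : ℂ) ^ signExp (-d * c ^ k) = -((d : ℤ) * ((c : ℤ) : ℂ) ^ k) :=
    fun k => by
      rw [neg_one_zpow_signExp, Units.val_mul, Int.cast_mul, units_cast_zpow, Units.val_neg,
        Int.cast_neg, neg_mul]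
  have hk : ∀ k : ℤ, ((k + 1 : ℤ) : ℂ) = k + 1 := fun k => by push_cast; rfl
  have hneg : ∀ k : ℤ, -((k + (0 : ℤ) + (1 : ℤ) : ℂ)) = -k - 1 := fun k => by push_cast; ring
  refine le_antisymm (h.fixedBy_inf_ker_le fun a b k f hf => ?_) (Submodule.span_le.2 ?_)
  · rw [h.map_tDM]
    obtain rfl | rfl := eq_zero_or_eq_one a <;> obtain rfl | rfl := eq_zero_or_eq_one b
    · refine Submodule.subset_span (Set.mem_iUnion.2 ⟨k, Or.inl (Or.inl ⟨f, hf, ?_⟩)⟩)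
      rw [hcast, hneg]
      simp [etaSign]
    · obtain ⟨F, hF, hF'⟩ := exists_affComp_half_eq (signExp (d * c ^ k)) (k + 1) hf
      refine Submodule.subset_span (Set.mem_iUnion.2 ⟨k, Or.inr ⟨F, hF, ?_⟩⟩)
      rw [hk] at hF'
      rw [← hF', tDM_add, tDM_smul, hplus]
      simp [etaSign, one_add_one]
    -- The `M_-` generators are indexed with `t^{k-1}`, so `t^k` belongs to index `k + 1`; its
    -- parity sign `-d c^{k+2}` equals `-d c^k` since `c² = 1`.
    · obtain ⟨F, hF, hF'⟩ := exists_affComp_half_eq (signExp (-d * c ^ (k + 1 + 1))) (k + 1) hf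
      refine Submodule.subset_span (Set.mem_iUnion.2 ⟨k + 1, Or.inl (Or.inr ⟨F, hF, ?_⟩)⟩)
      have h2 : ((c : ℤ) : ℂ) ^ (k + 1 + 1) = ((c : ℤ) : ℂ) ^ k := by
        rw [zpow_add_one₀ hc0, zpow_add_one₀ hc0, mul_assoc, hc, mul_one]
      rw [← hF', tDM_add, tDM_smul, hminus, h2]
      simp [etaSign, one_add_one, sub_eq_add_neg]
    -- A monomial in `M_1` yields the same family: its antisymmetrisation has `M_0` coefficient
    -- `-c^k f(-D-k-1)`, and reflecting that returns `f`.
    · have hf' := affComp_neg_one_mem_I_inter hf (k + 1)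
      refine Submodule.subset_span (Set.mem_iUnion.2 ⟨k, Or.inl (Or.inl
        ⟨_, smul_mem_I hf' (-((c : ℤ) : ℂ) ^ k), ?_⟩)⟩)
      have hff : affComp (-1) (-k - 1) (affComp (-1) (-(k + 1 : ℤ)) f) = f :=
        entire_ext fun w => congrArg f.1 (by push_cast; ring)
      rw [hcast, map_smul, hff, tDM_smul, tDM_smul, smul_smul, mul_neg, hcc]
      simp [etaSign, one_add_one, neg_add_eq_sub]
  · refine Set.iUnion_subset fun k => ?_
    rintro x ((⟨f, hf, rfl⟩ | ⟨f, hf, rfl⟩) | ⟨f, hf, rfl⟩)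
    · have h1 := h.sub_mem_fixedBy_inf_ker hf k 0 0
      rw [h.map_tDM] at h1
      rw [hcast, ← hneg]
      change _ ∈ fixedBy (sigmaSign c d) ⊓ LinearMap.ker (phi s)
      convert h1 using 1
      simp [etaSign]
    · refine ⟨IsReflection.mem_fixedBy.2 ?_, phi_tDM_eq_zero (affComp_half_mem_I hf) _ _ _⟩
      have h1 := affComp_neg_affComp_half hf
      have h2 : -(((k - 1 : ℤ) : ℂ) + (0 : ℤ) + (1 : ℤ)) = -k := by push_cast; ring
      have h3 := hcc (k - 1)
      have h4 : ((c : ℤ) : ℂ) ^ (k + 1) = ((c : ℤ) : ℂ) ^ (k - 1) := by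
        rw [← sub_add_cancel k 1, zpow_add_one₀ hc0, zpow_add_one₀ hc0, mul_assoc, hc, mul_one,
          sub_add_cancel]
      rw [hminus, h4] at h1
      have h5 : ((d : ℤ) : ℂ) * ((c : ℤ) : ℂ) ^ (k - 1) *
          -(((d : ℤ) : ℂ) * ((c : ℤ) : ℂ) ^ (k - 1)) = -1 := by
        linear_combination (-((d : ℤ) : ℂ) * ((d : ℤ) : ℂ)) * h3 - hd
      rw [h.map_tDM, h2, h1, tDM_smul, smul_smul]
      simp only [etaSign, one_add_one, zero_add, add_zero, sub_zero]
      rw [if_neg (by decide), if_neg (by decide), h5, neg_one_smul]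
    · have h0 := affComp_half_mem_I hf
      have h1 := affComp_neg_affComp_half hf
      have h2 : -((k : ℂ) + (0 : ℤ) + (1 : ℤ)) = -(k + 1 : ℤ) := by push_cast; ring
      have h3 := hcc k
      rw [hplus] at h1
      have h5 : -((d : ℤ) : ℂ) * ((c : ℤ) : ℂ) ^ k * (((d : ℤ) : ℂ) * ((c : ℤ) : ℂ) ^ k) = -1 := by
        linear_combination (-((d : ℤ) : ℂ) * ((d : ℤ) : ℂ)) * h3 - hd
      rw [← hk]
      refine ⟨IsReflection.mem_fixedBy.2 ?_, phi_tDM_eq_zero h0 _ _ _⟩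
      rw [h.map_tDM, h2, h1, tDM_smul, smul_smul]
      simp only [etaSign, one_add_one, zero_add, add_zero, sub_zero]
      rw [if_neg (by decide), if_pos trivial, h5, neg_one_smul]

/-! ### Assembling the exact sequences -/

theorem IsReflection.phiShortExact {σ : SD →ₗ[ℂ] SD} {γ : ℂ} {η : ZMod 2 → ZMod 2 → ℂ}
    {π : ZMod 2 → ZMod 2} {κ : ZMod 2 → ℤ} {r : ℤ} (h : IsReflection σ γ η π κ r) {s : ℂ}
    {J : Submodule ℂ SD} {G : Submodule ℂ (Module.End ℂ V)}
    (hJ : fixedBy σ ⊓ LinearMap.ker (phi s) = J) (hG : (fixedBy σ).map (phi s) = G) :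
    PhiShortExact s J (fixedBy σ) G := by
  unfold PhiShortExact
  refine IsLieSubsuperalgebra.isShortExact (A := SD) (B := Module.End ℂ V) (𝒜 := SDParity)
    (ℬ := EndParity) (L := fixedBy σ) (φ := phi s) (J := J) (G := G) ?_ ?_ ?_ ?_ ?_
  · exact h.isLieSubsuperalgebra
  · exact phi_mem_EndParity s
  · exact phi_mul s
  · exact hJ
  · exact hG

end SuperCircle

theorem mainTheorem6 :
    -- the subalgebra `⁰SD`
    ((∀ s : ℂ, (∀ n : ℤ, s ≠ n / 2) →
        SuperCircle.PhiShortExact s (SuperCircle.JZero s) SuperCircle.SDZero SuperCircle.gl) ∧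
      SuperCircle.PhiShortExact 0 (SuperCircle.JZero 0) SuperCircle.SDZero SuperCircle.ospB) ∧
    -- the four subalgebras `^{±±}SD`, indexed by the two signs `c`, `d`
    (∀ c d : ℤˣ,
      (∀ s : ℂ, (∀ n : ℤ, s ≠ n / 2) →
        SuperCircle.PhiShortExact s (SuperCircle.JSign c d s) (SuperCircle.SDSign c d)
          SuperCircle.gl) ∧
      SuperCircle.PhiShortExact 0 (SuperCircle.JSign c d 0) (SuperCircle.SDSign c d)
        (SuperCircle.typeP c d)) := by
  have h0 := SuperCircle.isReflection_sigmaZero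
  refine ⟨⟨fun s hs => h0.phiShortExact (SuperCircle.sigmaZero_ker s) (h0.map_phi_fixedBy_eq_gl hs),
    h0.phiShortExact (SuperCircle.sigmaZero_ker 0) (h0.map_phi_fixedBy_eq_preserving
      SuperCircle.sigmaZero_adjoint SuperCircle.formOSP_nondegenerate)⟩, fun c d => ?_⟩
  have h := SuperCircle.isReflection_sigmaSign c d
  exact ⟨fun s hs => h.phiShortExact (SuperCircle.sigmaSign_ker c d s)
    (h.map_phi_fixedBy_eq_gl hs), h.phiShortExact (SuperCircle.sigmaSign_ker c d 0)
    (h.map_phi_fixedBy_eq_preserving (SuperCircle.sigmaSign_adjoint c d)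
      (SuperCircle.formOdd_nondegenerate c (c * d)))⟩
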